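/- For $n \ge 0$ let $F_n$ be the free group on $x_1,\dots,x_n$, $A_n = \mathrm{Aut}(F_n)$, $H = H_{[n]} = F_n^{\mathrm{ab}}$ its abelianization, $[\gamma] \in H$ the class of $\gamma \in F_n$, and $H^* = \mathrm{Hom}(H,\mathbb{Z})$, with the natural actions of $A_n$. Let $\overline{A}_n = F_n \rtimes A_n$, let $\pi\colon \overline{A}_n \to A_n$ be the projection, and let $k_0 \in H^1(\overline{A}_n; H)$ be the class of the cocycle $(\gamma,\varphi) \mapsto [\gamma]$. For an $A_n$-module $M$ let $$\pi_\sharp\colon H^{p+1}(\overline{A}_n; M) \to H^p(A_n; H^1(F_n; M)) = H^p(A_n; H^* \otimes M)$$ be the Gysin map of the extension $F_n \to \overline{A}_n \to A_n$, that is, the edge map of its Lyndon–Hochschild–Serre spectral sequence. For $p \ge 1$ put $$h_p = \pi_\sharp(k_0^{\otimes (p+1)}) \in H^p(A_n; H^* \otimes H^{\otimes (p+1)}), \qquad \overline{h}_p = (r_p)_* h_p \in H^p(A_n; H^{\otimes p}),$$ where $k_0^{\otimes (p+1)} \in H^{p+1}(\overline{A}_n; H^{\otimes (p+1)})$ is the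 cup power and $r_p\colon H^* \otimes H^{\otimes (p+1)} \to H^{\otimes p}$ is the contraction $f \otimes v_0 \otimes v_1 \otimes \cdots \otimes v_p \mapsto f(v_0)\, v_1 \otimes \cdots \otimes v_p$. **Proposition 1.2.** Let $n_1, n_2, n \ge 0$ with $n_1 + n_2 \le n$. Let $\iota\colon A_{n_1} \times A_{n_2} \to A_n$ be the block inclusion, in which $A_{n_1}$ acts on words in $x_1,\dots,x_{n_1}$, $A_{n_2}$ acts on words in $x_{n_1+1},\dots,x_{n_1+n_2}$, and the remaining letters are fixed, and let $\varpi_k\colon A_{n_1} \times A_{n_2} \to A_{n_k}$ ($k = 1, 2$) be the projections. Let $H_{(n_1)}$, $H_{(n_2)}$, $H_{(n-n_1-n_2)}$ be the submodules of $H = H_{[n]}$ spanned by the classes of $x_1,\dots,x_{n_1}$, of $x_{n_1+1},\dots,x_{n_1+n_2}$ and of the remaining letters. Identify $H_{[n_k]}$ with $H_{(n_k)}$, and let $$\varpi_k^*\colon H^p(A_{n_k}; H_{(n_k)}^* \otimes H_{(n_k)}^{\otimes (p+1)}) \to H^p(A_{n_1} \times A_{n_2}; H^* \otimes H^{\otimes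 (p+1)}), \qquad \varpi_k^*\colon H^p(A_{n_k}; H_{(n_k)}^{\otimes p}) \to H^p(A_{n_1} \times A_{n_2}; H^{\otimes p})$$ be the maps induced by $\varpi_k$ and by the inclusions of coefficients coming from the decomposition $H = H_{(n_1)} \oplus H_{(n_2)} \oplus H_{(n-n_1-n_2)}$. Then for every $p \ge 1$: 1. $\iota^* h_p = \varpi_1^* h_p + \varpi_2^* h_p \in H^p(A_{n_1} \times A_{n_2}; H^* \otimes H^{\otimes (p+1)})$, 2. $\iota^* \overline{h}_p = \varpi_1^* \overline{h}_p + \varpi_2^* \overline{h}_p \in H^p(A_{n_1} \times A_{n_2}; H^{\otimes p})$. -/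

import Mathlib

open CategoryTheory
open scoped TensorProduct

noncomputable section

namespace TwistedMM

/-! ## Tensor powers of representations and powers of degree one cocycles -/

/-- The diagonal action of `G` on the tensor power `V^{⊗ p}`. -/
def tensorPowRep {R G V : Type} [CommRing R] [Group G] [AddCommGroup V] [Module R V]
    (ρ : Representation R G V) (p : ℕ) : Representation R G (⨂[R]^p V) where
  toFun g := PiTensorProduct.map fun _ => ρ g
  map_one' := by
    simp only [map_one]
    exact PiTensorProduct.map_one
  map_mul' g h := by
    simp only [map_mul]
    exact PiTensorProduct.map_mul _ _

/-- The `m`-fold Alexander--Whitney cup power of a `1`-cochain `k`: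
`(g_1, …, g_m) ↦ k(g_1) ⊗ g_1 k(g_2) ⊗ ⋯ ⊗ (g_1 ⋯ g_{m-1}) k(g_m)`. -/
def cupPow {R G V : Type} [CommRing R] [Group G] [AddCommGroup V] [Module R V]
    (ρ : Representation R G V) (k : G → V) (m : ℕ) : (Fin m → G) → ⨂[R]^m V :=
  fun g => PiTensorProduct.tprod R fun i => ρ (Fin.partialProd g i.castSucc) (k (g i))

theorem alternating_telescope {R M : Type} [CommRing R] [AddCommGroup M] [Module R M] (m : ℕ)
    (D : Fin (m + 1) → M) :
    D 0 + ((∑ j : Fin m, (-1 : R) ^ ((j : ℕ) + 1) • (D j.castSucc + D j.succ)) +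
      (-1 : R) ^ (m + 1) • D (Fin.last m)) = 0 := by
  induction m with
  | zero => simp
  | succ m ih =>
    rw [Fin.sum_univ_castSucc]
    have h := ih fun i => D i.castSucc
    simp only [Fin.castSucc_zero, Fin.val_castSucc, Fin.val_last, Fin.succ_last, ← Fin.succ_castSucc]
      at h ⊢
    rw [← h]
    simp only [pow_succ, smul_add]
    module

/-- Powers of `1`-cocycles are cocycles. -/
theorem d_cupPow {R G V : Type} [CommRing R] [Group G] [AddCommGroup V] [Module R V]
    (ρ : Representation R G V) (k : G → V) (hk : ∀ g h, k (g * h) = k g + ρ g (k h)) (m : ℕ) :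
    inhomogeneousCochains.d (Rep.of (tensorPowRep ρ m)) m (cupPow ρ k m) = 0 := by
  classical
  have key : ∀ (l : ℕ) (g : Fin l → G) (i : Fin l),
      ρ (Fin.partialProd g i.castSucc) (k (g i)) =
        k (Fin.partialProd g i.succ) - k (Fin.partialProd g i.castSucc) := by
    intro l g i
    rw [Fin.partialProd_succ, hk]
    abel
  ext g
  let c : Fin (m + 2) → V := fun i => k (Fin.partialProd g i)
  let a : Fin (m + 1) → V := fun i => c i.succ - c i.castSucc
  let D : Fin (m + 1) → ⨂[R]^m V := fun j => PiTensorProduct.tprod R fun i => a (j.succAbove i)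
  have hcon : ∀ j : Fin (m + 1), cupPow ρ k m (Fin.contractNth j (· * ·) g) =
      PiTensorProduct.tprod R fun i : Fin m =>
        c (j.succ.succAbove i.succ) - c (j.succ.succAbove i.castSucc) := by
    intro j
    simp only [cupPow, key]
    simp only [Fin.partialProd_contractNth, Function.comp_apply, c]
  have h0 : tensorPowRep ρ m (g 0) (cupPow ρ k m fun i => g i.succ) = D 0 := by
    change PiTensorProduct.map (fun _ => ρ (g 0)) (PiTensorProduct.tprod R _) = _
    rw [PiTensorProduct.map_tprod]
    refine congrArg _ (funext fun i => ?_)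
    simp only [a, c, Fin.succAbove_zero, ← key]
    rw [Fin.castSucc_succ, Fin.partialProd_succ', map_mul]
    rfl
  have hlast : cupPow ρ k m (Fin.contractNth (Fin.last m) (· * ·) g) = D (Fin.last m) := by
    rw [hcon]
    refine congrArg _ (funext fun i => ?_)
    simp only [a, Fin.succ_last, Fin.succAbove_last, Fin.succ_castSucc]
  have hmid : ∀ j : Fin m, cupPow ρ k m (Fin.contractNth j.castSucc (· * ·) g) =
      D j.castSucc + D j.succ := by
    intro j
    let b : Fin m → V := fun i => a (j.castSucc.succAbove i)
    have e₁ : D j.castSucc = PiTensorProduct.tprod R (Function.update b j (a j.succ)) := by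
      refine congrArg (PiTensorProduct.tprod R) (funext fun i => ?_)
      rcases eq_or_ne i j with rfl | hij
      · simp
      · simp [b, hij]
    have e₂ : D j.succ = PiTensorProduct.tprod R (Function.update b j (a j.castSucc)) := by
      refine congrArg (PiTensorProduct.tprod R) (funext fun i => ?_)
      rcases lt_trichotomy i j with hij | rfl | hij
      · simp only [Function.update_of_ne hij.ne, b]
        rw [Fin.succAbove_of_castSucc_lt _ _ (by rw [Fin.lt_def] at hij; simp only [Fin.lt_def, Fin.val_castSucc, Fin.val_succ]; omega),
          Fin.succAbove_of_castSucc_lt _ _ (by simpa using hij)]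
      · simp
      · simp only [Function.update_of_ne hij.ne', b]
        rw [Fin.succAbove_of_le_castSucc _ _ (by rw [Fin.lt_def] at hij; simp only [Fin.le_def, Fin.val_castSucc, Fin.val_succ]; omega),
          Fin.succAbove_of_le_castSucc _ _ (by simpa using hij.le)]
    rw [hcon, e₁, e₂, add_comm (PiTensorProduct.tprod R _), ← MultilinearMap.map_update_add]
    refine congrArg (PiTensorProduct.tprod R) (funext fun i => ?_)
    rcases lt_trichotomy i j with hij | rfl | hij
    · simp only [Function.update_of_ne hij.ne, b, a]
      rw [Fin.succAbove_of_castSucc_lt _ _ (by rw [Fin.lt_def] at hij; simp only [Fin.lt_def, Fin.val_castSucc, Fin.val_succ]; omega),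
        Fin.succAbove_of_castSucc_lt _ _ (by rw [Fin.lt_def] at hij; simp only [Fin.lt_def, Fin.val_castSucc, Fin.val_succ]; omega),
        Fin.succAbove_of_castSucc_lt _ _ (by simpa using hij)]
      rfl
    · simp only [Function.update_self, a]
      rw [Fin.succAbove_of_le_castSucc _ _ (by simp),
        Fin.succAbove_of_castSucc_lt _ _ (by simp)]
      simp only [Fin.succ_castSucc]
      abel
    · simp only [Function.update_of_ne hij.ne', b, a]
      rw [Fin.succAbove_of_le_castSucc _ _ (by rw [Fin.lt_def] at hij; simp only [Fin.le_def, Fin.val_castSucc, Fin.val_succ]; omega),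
        Fin.succAbove_of_le_castSucc _ _ (by rw [Fin.lt_def] at hij; simp only [Fin.le_def, Fin.val_castSucc, Fin.val_succ]; omega),
        Fin.succAbove_of_le_castSucc _ _ (by simpa using hij.le)]
      rfl
  rw [inhomogeneousCochains.d_hom_apply, Fin.sum_univ_castSucc]
  simp only [hmid, hlast]
  exact (congrArg (· + _) h0).trans (alternating_telescope (R := R) m D)

/-- The representation `V^* ⊗ M`. -/
def dualTensor {R G V : Type} [CommRing R] [Group G] [AddCommGroup V] [Module R V]
    (ρ : Representation R G V) (M : Rep.{0} R G) : Rep.{0} R G :=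
  Rep.of (X := Module.Dual R V ⊗[R] M.V) (ρ.dual.tprod M.ρ)

/-- The value at `v ∈ V` of an element of `V^* ⊗ M`, regarded as an element of `Hom(V, M)` through
`f ⊗ m ↦ (v ↦ f(v) m)`. -/
def dualTensorEval {R G V : Type} [CommRing R] [Group G] [AddCommGroup V] [Module R V]
    {ρ : Representation R G V} {M : Rep.{0} R G} (t : (dualTensor ρ M).V) (v : V) : M.V :=
  dualTensorHom R V M.V (show Module.Dual R V ⊗[R] M.V from t) v

/-! ## Free groups, their automorphism groups and their abelianizations -/

/-- The free group of rank `n` on the basis `x_0, …, x_{n-1}`. -/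
abbrev F (n : ℕ) : Type := FreeGroup (Fin n)

/-- The automorphism group of the free group of rank `n`. -/
abbrev A (n : ℕ) : Type := MulAut (F n)

/-- `H = H_1(F_n; ℤ)`, the abelianization of `F_n`, written additively. -/
abbrev H (n : ℕ) : Type := Additive (Abelianization (F n))

/-- The class `[γ] ∈ H` of `γ ∈ F_n`. -/
def cls {n : ℕ} (γ : F n) : H n := Additive.ofMul (Abelianization.of γ)

/-- The map on abelianizations induced by a homomorphism of free groups. -/
def hMap {m n : ℕ} (f : F m →* F n) : H m →ₗ[ℤ] H n :=
  (MonoidHom.toAdditive (Abelianization.map f)).toIntLinearMap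

theorem hMap_cls {m n : ℕ} (f : F m →* F n) (γ : F m) : hMap f (cls γ) = cls (f γ) := rfl

theorem cls_surjective {n : ℕ} : Function.Surjective (cls (n := n)) := by
  intro v
  obtain ⟨γ, h⟩ := QuotientGroup.mk_surjective (Additive.toMul v)
  exact ⟨γ, congrArg Additive.ofMul h⟩

theorem hMap_comp {l m n : ℕ} (f : F m →* F n) (g : F l →* F m) :
    hMap f ∘ₗ hMap g = hMap (f.comp g) := by
  refine LinearMap.ext fun v => ?_
  obtain ⟨γ, rfl⟩ := cls_surjective v
  rfl

/-- The natural action of `Aut(F_n)` on `H`. -/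
def hRep (n : ℕ) : Representation ℤ (A n) (H n) where
  toFun φ := hMap φ.toMonoidHom
  map_one' := by
    refine LinearMap.ext fun v => ?_
    obtain ⟨γ, rfl⟩ := cls_surjective v
    rfl
  map_mul' φ ψ := by
    refine LinearMap.ext fun v => ?_
    obtain ⟨γ, rfl⟩ := cls_surjective v
    rfl

/-- The `Aut(F_n)`-module `H^{⊗ p}`. -/
def tensorMod (n p : ℕ) : Rep.{0} ℤ (A n) := Rep.of (tensorPowRep (hRep n) p)

/-- The `Aut(F_n)`-module `H^* ⊗ M`, where `H^* = Hom(H, ℤ)`. -/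
abbrev dualTensorMod {n : ℕ} (M : Rep.{0} ℤ (A n)) : Rep.{0} ℤ (A n) :=
  dualTensor (hRep n) M

/-! ## The extension `F_n → F_n ⋊ Aut(F_n) → Aut(F_n)` and its Gysin map -/

/-- The semidirect product `F_n ⋊ Aut(F_n)`. -/
abbrev Abar (n : ℕ) : Type := F n ⋊[MonoidHom.id (A n)] A n

/-- The projection `π : F_n ⋊ Aut(F_n) → Aut(F_n)`. -/
abbrev proj (n : ℕ) : Abar n →* A n := SemidirectProduct.rightHom

/-- The map `k_0 : F_n ⋊ Aut(F_n) → H`, `(γ, φ) ↦ [γ]`. -/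
def k0 (n : ℕ) : Abar n → H n := fun g => cls g.left

theorem k0_mul (n : ℕ) (g h : Abar n) :
    k0 n (g * h) = k0 n g + ((hRep n).comp (proj n)) g (k0 n h) := rfl

/-- The class `k_0^{⊗ m} ∈ H^m(F_n ⋊ Aut(F_n); H^{⊗ m})`. -/
def k0Pow (n m : ℕ) : groupCohomology (Rep.res (proj n) (tensorMod n m)) m :=
  groupCohomology.π (Rep.res (proj n) (tensorMod n m)) m
    (groupCohomology.cocyclesMk (A := Rep.res (proj n) (tensorMod n m))
      (cupPow ((hRep n).comp (proj n)) (k0 n) m)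
      (d_cupPow ((hRep n).comp (proj n)) (k0 n) (k0_mul n) m))

/-- The graph of the Gysin map
`H^{p+1}(F_n ⋊ Aut(F_n); M) → H^p(Aut(F_n); H^1(F_n; M)) = H^p(Aut(F_n); H^* ⊗ M)`
for an `Aut(F_n)`-module `M`, i.e. of the edge map of the Lyndon--Hochschild--Serre spectral
sequence, whose rows other than `0` and `1` vanish. In terms of the Hochschild--Serre filtration of
the normalized standard complex: `c` is represented by a normalized cocycle `f` which lies
in the `p`-th filtration step (it depends on its last `p` arguments only through their images in
`Aut(F_n)`), and `d` is represented by the cocycle `u` obtained from `f` by restricting the first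
argument to `F_n`, where `u(φ_1, …, φ_p) ∈ H^* ⊗ M = Hom(H, M) = H^1(F_n; M)` is the homomorphism
`[γ] ↦ f(γ, φ_1, …, φ_p)`. -/
def IsGysin {n : ℕ} (p : ℕ) (M : Rep.{0} ℤ (A n))
    (c : groupCohomology (Rep.res (proj n) M) (p + 1))
    (d : groupCohomology (dualTensorMod M) p) : Prop :=
  ∃ (f : groupCohomology.cocycles (Rep.res (proj n) M) (p + 1))
    (u : groupCohomology.cocycles (dualTensorMod M) p)
    (f' : (Fin (p + 1) → Abar n) → M.V)
    (u' : (Fin p → A n) → (dualTensorMod M).V),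
    groupCohomology.π (Rep.res (proj n) M) (p + 1) f = c ∧
    groupCohomology.π (dualTensorMod M) p u = d ∧
    groupCohomology.iCocycles (Rep.res (proj n) M) (p + 1) f = f' ∧
    groupCohomology.iCocycles (dualTensorMod M) p u = u' ∧
    (∀ g : Fin (p + 1) → Abar n, (∃ i, g i = 1) → f' g = 0) ∧
    (∀ (g : Abar n) (a b : Fin p → Abar n), (∀ i, proj n (a i) = proj n (b i)) →
      f' (Fin.cons g a) = f' (Fin.cons g b)) ∧
    (∀ (γ : F n) (a : Fin p → Abar n),
      f' (Fin.cons (SemidirectProduct.inl γ) a) =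
        dualTensorEval (u' fun i => proj n (a i)) (cls γ))

/-- The Gysin map `π_♯ : H^{p+1}(F_n ⋊ Aut(F_n); M) → H^p(Aut(F_n); H^* ⊗ M)`: the class `d` that
corresponds to `c`. As `H^q(F_n; M) = 0` for `q ≥ 2`, the `p`-th filtration step is all of
`H^{p+1}(F_n ⋊ Aut(F_n); M)` and no nonzero differential of the spectral sequence ends in
bidegree `(p, 1)`, so for every `c` there is exactly one such `d`. -/
def gysin {n : ℕ} (p : ℕ) (M : Rep.{0} ℤ (A n))
    (c : groupCohomology (Rep.res (proj n) M) (p + 1)) :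
    groupCohomology (dualTensorMod M) p :=
  Classical.epsilon (IsGysin p M c)

/-! ## The twisted Morita--Mumford classes -/

/-- The coefficient module `H^* ⊗ H^{⊗ (p+1)}`. -/
abbrev hCoeff (n p : ℕ) : Rep.{0} ℤ (A n) := dualTensorMod (tensorMod n (p + 1))

/-- The class `h_p = π_♯(k_0^{⊗ (p+1)}) ∈ H^p(Aut(F_n); H^* ⊗ H^{⊗ (p+1)})`. -/
def hClass (n p : ℕ) : groupCohomology (hCoeff n p) p :=
  gysin p (tensorMod n (p + 1)) (k0Pow n (p + 1))

/-- The contraction `V^* ⊗ V^{⊗ (p+1)} → V^{⊗ p}`,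
`f ⊗ v_0 ⊗ v_1 ⊗ ⋯ ⊗ v_p ↦ f(v_0) v_1 ⊗ ⋯ ⊗ v_p`. -/
def contraction (R V : Type) [CommRing R] [AddCommGroup V] [Module R V] (p : ℕ) :
    Module.Dual R V ⊗[R] (⨂[R]^(p + 1) V) →ₗ[R] ⨂[R]^p V :=
  TensorProduct.lift
    { toFun := fun f => PiTensorProduct.lift
        (LinearMap.uncurryLeft (M := fun _ : Fin (p + 1) => V)
          (f.smulRight (PiTensorProduct.tprod R : MultilinearMap R (fun _ : Fin p => V) _)))
      map_add' := fun f g => by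
        ext v
        simp [add_smul]
      map_smul' := fun r f => by
        ext v
        simp [mul_smul] }

theorem contraction_tmul_tprod (R V : Type) [CommRing R] [AddCommGroup V] [Module R V] (p : ℕ)
    (f : Module.Dual R V) (v : Fin (p + 1) → V) :
    contraction R V p (f ⊗ₜ PiTensorProduct.tprod R v) =
      f (v 0) • PiTensorProduct.tprod R (Fin.tail v) := by
  simp [contraction]

theorem contraction_comm {R G V : Type} [CommRing R] [Group G] [AddCommGroup V] [Module R V]
    (ρ : Representation R G V) (p : ℕ) (g : G) :
    contraction R V p ∘ₗ (ρ.dual.tprod (tensorPowRep ρ (p + 1))) g =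
      tensorPowRep ρ p g ∘ₗ contraction R V p := by
  ext f v
  simp [contraction_tmul_tprod, tensorPowRep, Representation.tprod_apply, Module.Dual.transpose_apply]
  rfl

/-- The contraction `r_p : H^* ⊗ H^{⊗ (p+1)} → H^{⊗ p}` as a map of `Aut(F_n)`-modules. -/
def rMap (n p : ℕ) : hCoeff n p ⟶ tensorMod n p :=
  Rep.ofHom ⟨contraction ℤ (H n) p, contraction_comm (hRep n) p⟩

/-- The class `h̄_p = (r_p)_* h_p ∈ H^p(Aut(F_n); H^{⊗ p})`. -/
def hBarClass (n p : ℕ) : groupCohomology (tensorMod n p) p :=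
  groupCohomology.map (MonoidHom.id (A n)) (rMap n p) p (hClass n p)

/-! ## The block inclusion `Aut(F_{n₁}) × Aut(F_{n₂}) → Aut(F_n)` -/

section Block

variable {n₁ n₂ n : ℕ}

/-- `F_{n₁} → F_n`, onto the subgroup generated by the first `n₁` letters. -/
def inc₁ (h : n₁ + n₂ ≤ n) : F n₁ →* F n :=
  FreeGroup.lift fun i => FreeGroup.of ⟨i, by omega⟩

/-- `F_{n₂} → F_n`, onto the subgroup generated by the `n₂` letters following the first `n₁`. -/
def inc₂ (h : n₁ + n₂ ≤ n) : F n₂ →* F n :=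
  FreeGroup.lift fun i => FreeGroup.of ⟨n₁ + i, by omega⟩

/-- `F_n → F_{n₁}`, killing all letters but the first `n₁`. -/
def ret₁ (_ : n₁ + n₂ ≤ n) : F n →* F n₁ :=
  FreeGroup.lift fun i => if hi : (i : ℕ) < n₁ then FreeGroup.of ⟨i, hi⟩ else 1

/-- `F_n → F_{n₂}`, killing all letters but the `n₂` letters following the first `n₁`. -/
def ret₂ (_ : n₁ + n₂ ≤ n) : F n →* F n₂ :=
  FreeGroup.lift fun i =>
    if hi : n₁ ≤ (i : ℕ) ∧ (i : ℕ) < n₁ + n₂ then FreeGroup.of ⟨i - n₁, by omega⟩ else 1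

/-- The endomorphism of `F_n` given by `φ.1` on the first `n₁` letters, by `φ.2` on the `n₂`
following letters and by the identity on the remaining letters. -/
def blockHom (h : n₁ + n₂ ≤ n) (φ : A n₁ × A n₂) : F n →* F n :=
  FreeGroup.lift fun i =>
    if h₁ : (i : ℕ) < n₁ then inc₁ h (φ.1 (FreeGroup.of ⟨i, h₁⟩))
    else if h₂ : (i : ℕ) < n₁ + n₂ then inc₂ h (φ.2 (FreeGroup.of ⟨i - n₁, by omega⟩))
    else FreeGroup.of i

theorem blockHom_comp_inc₁ (h : n₁ + n₂ ≤ n) (φ : A n₁ × A n₂) :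
    (blockHom h φ).comp (inc₁ h) = (inc₁ h).comp φ.1.toMonoidHom := by
  ext i
  simp [blockHom, inc₁]

theorem blockHom_comp_inc₂ (h : n₁ + n₂ ≤ n) (φ : A n₁ × A n₂) :
    (blockHom h φ).comp (inc₂ h) = (inc₂ h).comp φ.2.toMonoidHom := by
  ext i
  simp [blockHom, inc₂]

theorem ret₁_comp_inc₁ (h : n₁ + n₂ ≤ n) : (ret₁ h).comp (inc₁ h) = MonoidHom.id _ := by
  ext i
  simp [ret₁, inc₁]

theorem ret₁_comp_inc₂ (h : n₁ + n₂ ≤ n) : (ret₁ h).comp (inc₂ h) = 1 := by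
  ext i
  simp [ret₁, inc₂]

theorem ret₂_comp_inc₁ (h : n₁ + n₂ ≤ n) : (ret₂ h).comp (inc₁ h) = 1 := by
  ext i
  have := i.2
  simp [ret₂, inc₁]

theorem ret₂_comp_inc₂ (h : n₁ + n₂ ≤ n) : (ret₂ h).comp (inc₂ h) = MonoidHom.id _ := by
  ext i
  simp [ret₂, inc₂]

theorem ret₁_comp_blockHom (h : n₁ + n₂ ≤ n) (φ : A n₁ × A n₂) :
    (ret₁ h).comp (blockHom h φ) = φ.1.toMonoidHom.comp (ret₁ h) := by
  have e₁ := DFunLike.congr_fun (ret₁_comp_inc₁ h)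
  have e₂ := DFunLike.congr_fun (ret₁_comp_inc₂ h)
  simp only [MonoidHom.comp_apply, MonoidHom.id_apply, MonoidHom.one_apply] at e₁ e₂
  ext i
  by_cases h₁ : (i : ℕ) < n₁
  · simp [blockHom, h₁, e₁]
    simp [ret₁, h₁]
  · by_cases h₂ : (i : ℕ) < n₁ + n₂ <;> simp [blockHom, h₁, h₂, e₂] <;> simp [ret₁, h₁]

theorem ret₂_comp_blockHom (h : n₁ + n₂ ≤ n) (φ : A n₁ × A n₂) :
    (ret₂ h).comp (blockHom h φ) = φ.2.toMonoidHom.comp (ret₂ h) := by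
  have e₁ := DFunLike.congr_fun (ret₂_comp_inc₁ h)
  have e₂ := DFunLike.congr_fun (ret₂_comp_inc₂ h)
  simp only [MonoidHom.comp_apply, MonoidHom.id_apply, MonoidHom.one_apply] at e₁ e₂
  ext i
  by_cases h₁ : (i : ℕ) < n₁
  · have : ¬ n₁ ≤ (i : ℕ) := by omega
    simp [blockHom, h₁, e₁]
    simp [ret₂, this]
  · have h₁' : n₁ ≤ (i : ℕ) := by omega
    by_cases h₂ : (i : ℕ) < n₁ + n₂ <;> simp [blockHom, h₁, h₂, e₂] <;> simp [ret₂, h₁', h₂]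

theorem blockHom_one (h : n₁ + n₂ ≤ n) : blockHom h (1 : A n₁ × A n₂) = MonoidHom.id _ := by
  ext i
  by_cases h₁ : (i : ℕ) < n₁
  · simp [blockHom, inc₁, h₁]
  · by_cases h₂ : (i : ℕ) < n₁ + n₂
    · have : n₁ + ((i : ℕ) - n₁) = i := by omega
      simp [blockHom, inc₂, h₁, h₂, this]
    · simp [blockHom, h₁, h₂]

theorem blockHom_mul (h : n₁ + n₂ ≤ n) (φ ψ : A n₁ × A n₂) :
    blockHom h (φ * ψ) = (blockHom h φ).comp (blockHom h ψ) := by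
  have e₁ := DFunLike.congr_fun (blockHom_comp_inc₁ h φ)
  have e₂ := DFunLike.congr_fun (blockHom_comp_inc₂ h φ)
  simp only [MonoidHom.comp_apply] at e₁ e₂
  ext i
  by_cases h₁ : (i : ℕ) < n₁
  · simp [blockHom, h₁]
    simpa [blockHom] using (e₁ _).symm
  · by_cases h₂ : (i : ℕ) < n₁ + n₂
    · simp [blockHom, h₁, h₂]
      simpa [blockHom] using (e₂ _).symm
    · simp [blockHom, h₁, h₂]

/-- The block inclusion `ι : Aut(F_{n₁}) × Aut(F_{n₂}) → Aut(F_n)`. -/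
def iota (h : n₁ + n₂ ≤ n) : A n₁ × A n₂ →* A n where
  toFun φ :=
    { toFun := blockHom h φ
      invFun := blockHom h φ⁻¹
      left_inv := fun γ => by
        rw [← MonoidHom.comp_apply, ← blockHom_mul, inv_mul_cancel, blockHom_one]; rfl
      right_inv := fun γ => by
        rw [← MonoidHom.comp_apply, ← blockHom_mul, mul_inv_cancel, blockHom_one]; rfl
      map_mul' := map_mul _ }
  map_one' := by
    ext γ
    exact DFunLike.congr_fun (blockHom_one h) γ
  map_mul' φ ψ := by
    ext γ
    exact DFunLike.congr_fun (blockHom_mul h φ ψ) γ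

theorem hMap_inc₁_comm (h : n₁ + n₂ ≤ n) (φ : A n₁ × A n₂) :
    hMap (inc₁ h) ∘ₗ hRep n₁ φ.1 = hRep n (iota h φ) ∘ₗ hMap (inc₁ h) :=
  (hMap_comp _ _).trans ((congrArg hMap (blockHom_comp_inc₁ h φ).symm).trans (hMap_comp _ _).symm)

theorem hMap_inc₂_comm (h : n₁ + n₂ ≤ n) (φ : A n₁ × A n₂) :
    hMap (inc₂ h) ∘ₗ hRep n₂ φ.2 = hRep n (iota h φ) ∘ₗ hMap (inc₂ h) :=
  (hMap_comp _ _).trans ((congrArg hMap (blockHom_comp_inc₂ h φ).symm).trans (hMap_comp _ _).symm)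

theorem hMap_ret₁_comm (h : n₁ + n₂ ≤ n) (φ : A n₁ × A n₂) :
    hMap (ret₁ h) ∘ₗ hRep n (iota h φ) = hRep n₁ φ.1 ∘ₗ hMap (ret₁ h) :=
  (hMap_comp _ _).trans ((congrArg hMap (ret₁_comp_blockHom h φ)).trans (hMap_comp _ _).symm)

theorem hMap_ret₂_comm (h : n₁ + n₂ ≤ n) (φ : A n₁ × A n₂) :
    hMap (ret₂ h) ∘ₗ hRep n (iota h φ) = hRep n₂ φ.2 ∘ₗ hMap (ret₂ h) :=
  (hMap_comp _ _).trans ((congrArg hMap (ret₂_comp_blockHom h φ)).trans (hMap_comp _ _).symm)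

end Block

/-! ## The maps `ι^*` and `ϖ_k^*` -/

/-- Maps `j : V → W` and `q : W → V` induce `V^* ⊗ V^{⊗ m} → W^* ⊗ W^{⊗ m}`,
`f ⊗ t ↦ (f ∘ q) ⊗ j^{⊗ m}(t)`. -/
def mixedMap {R V W : Type} [CommRing R] [AddCommGroup V] [Module R V] [AddCommGroup W]
    [Module R W] (j : V →ₗ[R] W) (q : W →ₗ[R] V) (m : ℕ) :
    Module.Dual R V ⊗[R] (⨂[R]^m V) →ₗ[R] Module.Dual R W ⊗[R] (⨂[R]^m W) :=
  TensorProduct.map (Module.Dual.transpose (R := R) q) (PiTensorProduct.map fun _ => j)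

theorem tensorPowRep_comm {R G G' V W : Type} [CommRing R] [Group G] [Group G']
    [AddCommGroup V] [Module R V] [AddCommGroup W] [Module R W]
    (ρ : Representation R G V) (σ : Representation R G' W) (j : V →ₗ[R] W) (m : ℕ) (g : G) (g' : G')
    (hj : j ∘ₗ ρ g = σ g' ∘ₗ j) :
    (PiTensorProduct.map fun _ => j) ∘ₗ tensorPowRep ρ m g =
      tensorPowRep σ m g' ∘ₗ (PiTensorProduct.map fun _ => j) := by
  change _ ∘ₗ (PiTensorProduct.map fun _ => ρ g) = (PiTensorProduct.map fun _ => σ g') ∘ₗ _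
  rw [← PiTensorProduct.map_comp, ← PiTensorProduct.map_comp, hj]

theorem mixedMap_comm {R G G' V W : Type} [CommRing R] [Group G] [Group G']
    [AddCommGroup V] [Module R V] [AddCommGroup W] [Module R W]
    (ρ : Representation R G V) (σ : Representation R G' W) (j : V →ₗ[R] W) (q : W →ₗ[R] V)
    (m : ℕ) (g : G) (g' : G') (hj : j ∘ₗ ρ g = σ g' ∘ₗ j)
    (hq : q ∘ₗ σ g'⁻¹ = ρ g⁻¹ ∘ₗ q) :
    mixedMap j q m ∘ₗ (ρ.dual.tprod (tensorPowRep ρ m)) g =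
      (σ.dual.tprod (tensorPowRep σ m)) g' ∘ₗ mixedMap j q m := by
  rw [mixedMap, Representation.tprod_apply, Representation.tprod_apply, ← TensorProduct.map_comp,
    ← TensorProduct.map_comp, tensorPowRep_comm ρ σ j m g g' hj]
  congr 1
  ext f w
  exact congrArg f (DFunLike.congr_fun hq w).symm

section Pullback

variable {n₁ n₂ n : ℕ}

/-- The pullback `ι^* : H^p(Aut(F_n); M) → H^p(Aut(F_{n₁}) × Aut(F_{n₂}); M)`. -/
def iotaPullback (h : n₁ + n₂ ≤ n) (M : Rep.{0} ℤ (A n)) (p : ℕ) :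
    groupCohomology M p ⟶ groupCohomology (Rep.res (iota h) M) p :=
  groupCohomology.map (iota h) (𝟙 (Rep.res (iota h) M)) p

/-- The inclusion `H_{(n₁)}^{⊗ p} → H^{⊗ p}`. -/
def tensorMap₁ (h : n₁ + n₂ ≤ n) (p : ℕ) :
    Rep.res (MonoidHom.fst (A n₁) (A n₂)) (tensorMod n₁ p) ⟶
      Rep.res (iota h) (tensorMod n p) :=
  Rep.ofHom ⟨PiTensorProduct.map fun _ => hMap (inc₁ h), fun φ =>
    tensorPowRep_comm (hRep n₁) (hRep n) (hMap (inc₁ h)) p φ.1 (iota h φ)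
      (hMap_inc₁_comm h φ)⟩

/-- The inclusion `H_{(n₂)}^{⊗ p} → H^{⊗ p}`. -/
def tensorMap₂ (h : n₁ + n₂ ≤ n) (p : ℕ) :
    Rep.res (MonoidHom.snd (A n₁) (A n₂)) (tensorMod n₂ p) ⟶
      Rep.res (iota h) (tensorMod n p) :=
  Rep.ofHom ⟨PiTensorProduct.map fun _ => hMap (inc₂ h), fun φ =>
    tensorPowRep_comm (hRep n₂) (hRep n) (hMap (inc₂ h)) p φ.2 (iota h φ)
      (hMap_inc₂_comm h φ)⟩

/-- The inclusion `H_{(n₁)}^* ⊗ H_{(n₁)}^{⊗ (p+1)} → H^* ⊗ H^{⊗ (p+1)}` given by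
`H = H_{(n₁)} ⊕ H_{(n₂)} ⊕ H_{(n-n₁-n₂)}`. -/
def coeffMap₁ (h : n₁ + n₂ ≤ n) (p : ℕ) :
    Rep.res (MonoidHom.fst (A n₁) (A n₂)) (hCoeff n₁ p) ⟶ Rep.res (iota h) (hCoeff n p) :=
  Rep.ofHom ⟨mixedMap (hMap (inc₁ h)) (hMap (ret₁ h)) (p + 1), fun φ =>
    mixedMap_comm (hRep n₁) (hRep n) (hMap (inc₁ h)) (hMap (ret₁ h)) (p + 1) φ.1 (iota h φ)
      (hMap_inc₁_comm h φ) (hMap_ret₁_comm h φ⁻¹)⟩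

/-- The inclusion `H_{(n₂)}^* ⊗ H_{(n₂)}^{⊗ (p+1)} → H^* ⊗ H^{⊗ (p+1)}` given by
`H = H_{(n₁)} ⊕ H_{(n₂)} ⊕ H_{(n-n₁-n₂)}`. -/
def coeffMap₂ (h : n₁ + n₂ ≤ n) (p : ℕ) :
    Rep.res (MonoidHom.snd (A n₁) (A n₂)) (hCoeff n₂ p) ⟶ Rep.res (iota h) (hCoeff n p) :=
  Rep.ofHom ⟨mixedMap (hMap (inc₂ h)) (hMap (ret₂ h)) (p + 1), fun φ =>
    mixedMap_comm (hRep n₂) (hRep n) (hMap (inc₂ h)) (hMap (ret₂ h)) (p + 1) φ.2 (iota h φ)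
      (hMap_inc₂_comm h φ) (hMap_ret₂_comm h φ⁻¹)⟩

/-- `ϖ_1^*` with coefficients `H^* ⊗ H^{⊗ (p+1)}`. -/
def varpi₁Pullback (h : n₁ + n₂ ≤ n) (p : ℕ) :
    groupCohomology (hCoeff n₁ p) p ⟶ groupCohomology (Rep.res (iota h) (hCoeff n p)) p :=
  groupCohomology.map (MonoidHom.fst (A n₁) (A n₂)) (coeffMap₁ h p) p

/-- `ϖ_2^*` with coefficients `H^* ⊗ H^{⊗ (p+1)}`. -/
def varpi₂Pullback (h : n₁ + n₂ ≤ n) (p : ℕ) :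
    groupCohomology (hCoeff n₂ p) p ⟶ groupCohomology (Rep.res (iota h) (hCoeff n p)) p :=
  groupCohomology.map (MonoidHom.snd (A n₁) (A n₂)) (coeffMap₂ h p) p

/-- `ϖ_1^*` with coefficients `H^{⊗ p}`. -/
def varpi₁PullbackBar (h : n₁ + n₂ ≤ n) (p : ℕ) :
    groupCohomology (tensorMod n₁ p) p ⟶ groupCohomology (Rep.res (iota h) (tensorMod n p)) p :=
  groupCohomology.map (MonoidHom.fst (A n₁) (A n₂)) (tensorMap₁ h p) p

/-- `ϖ_2^*` with coefficients `H^{⊗ p}`. -/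
def varpi₂PullbackBar (h : n₁ + n₂ ≤ n) (p : ℕ) :
    groupCohomology (tensorMod n₂ p) p ⟶ groupCohomology (Rep.res (iota h) (tensorMod n p)) p :=
  groupCohomology.map (MonoidHom.snd (A n₁) (A n₂)) (tensorMap₂ h p) p

end Pullback

end TwistedMM

end

/-!
The class `h_p` is represented by an explicit cocycle, and that cocycle is block diagonal on
`Aut(F_{n₁}) × Aut(F_{n₂})`; both assertions then hold already for cochains.

*The cocycle.* Let `θ : F_n → H ⊗ H` be the quadratic part of the Magnus expansion `x_i ↦ 1 + X_i`,
so that `θ(γδ) = θ(γ) + θ(δ) + [γ] ⊗ [δ]` and `θ(x_i) = 0`. The homomorphisms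
`τ(b) : [γ] ↦ θ(γ) - b θ(b⁻¹ γ)` form a `1`-cocycle `johnson` with values in `Hom(H, H ⊗ H)`, and on
`F_n ⋊ Aut(F_n)` the cochain `(γ, φ) ↦ φ θ(φ⁻¹ γ)` bounds the difference of `k_0 ∪ k_0` and the
evaluation of `τ` on `k_0`. Iterating, `k_0^{⊗ (p+1)}` is cohomologous to the evaluation on `k_0` of
the iterated composition product of `τ` (`exists_cupPow_eq`), a cocycle of the shape which `IsGysin`
requires (`isGysin_hCocycle`).

*Uniqueness.* As `gysin` is a choice among the classes satisfying `IsGysin`, one has to know that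
there is only one (`IsGysin.unique`): if a coboundary lies in the `p`-th step of the filtration, its
restriction to `F_n` in the first argument is a coboundary on `Aut(F_n)`. Instead of the spectral
sequence, this uses dimension shifting along `0 → M → Fun(G, M) → Q → 0` for `G = F_n ⋊ Aut(F_n)`:
the cocycle, its first argument turned into the argument of a function on `G`, takes values in
`Q^{F_n}`, which maps to `Hom(F_n, M)`, and inflation `H^*(Aut(F_n); Q^{F_n}) → H^*(G; Q)` is
injective (`exists_freeInvariant_primitive`). The only input is that `H^1(F_n; Q) = 0` for every such
`Q` (`freeH1Vanishes_shift`), which holds because derivations on a free group can be prescribed on a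
basis and therefore lift along surjections of coefficients.

*Block automorphisms.* The map `θ` is natural for homomorphisms sending letters to letters, so the
cocycle of `Aut(F_n)` restricts on the two blocks to those of `Aut(F_{n₁})` and `Aut(F_{n₂})`. For
`p ≥ 1` it vanishes on the remaining letters, which are fixed and killed by `θ` (`hCochain_iota`).
-/

open CategoryTheory
open scoped TensorProduct

noncomputable section

namespace TwistedMM

/-! ### Inhomogeneous cochains and cup products -/

section Cochains

variable {R G V W X : Type} [CommRing R] [Group G] [AddCommGroup V] [Module R V]
  [AddCommGroup W] [Module R W] [AddCommGroup X] [Module R X]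

/-- The alternating sum of the faces `c(…, g_j g_{j+1}, …)` and `c(g_0, …, g_{n-1})`, that is, all
the terms of the inhomogeneous differential of `c` but the first. -/
def faceSum (R : Type) {G V : Type} [CommRing R] [Group G] [AddCommGroup V] [Module R V] {n : ℕ}
    (c : (Fin n → G) → V) (g : Fin (n + 1) → G) : V :=
  ∑ j : Fin (n + 1), (-1 : R) ^ ((j : ℕ) + 1) • c (Fin.contractNth j (· * ·) g)

/-- The inhomogeneous differential, as a map of plain functions. -/
def cobd (ρ : Representation R G V) {n : ℕ} (c : (Fin n → G) → V) (g : Fin (n + 1) → G) : V :=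
  ρ (g 0) (c (Fin.tail g)) + faceSum R c g

theorem d_eq_cobd (M : Rep.{0} R G) {n : ℕ} (c : (Fin n → G) → M.V) :
    inhomogeneousCochains.d M n c = cobd M.ρ c := by
  ext g
  exact inhomogeneousCochains.d_hom_apply ..

theorem cobd_cobd (ρ : Representation R G V) {n : ℕ} (c : (Fin n → G) → V) :
    cobd ρ (cobd ρ c) = 0 := by
  have h := ConcreteCategory.congr_hom (groupCohomology.inhomogeneousCochains.d_comp_d n (Rep.of ρ)) c
  rw [← d_eq_cobd (Rep.of ρ), ← d_eq_cobd (Rep.of ρ)]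
  exact h

theorem contractNth_zero_cons {n : ℕ} (x : G) (g : Fin (n + 1) → G) :
    Fin.contractNth 0 (· * ·) (Fin.cons x g : Fin (n + 2) → G) =
      Fin.cons (x * g 0) (Fin.tail g) := by
  ext i
  refine Fin.cases ?_ (fun i => ?_) i
  · rw [Fin.contractNth_apply_of_eq _ _ _ _ (by simp)]
    simp
  · rw [Fin.contractNth_apply_of_gt _ _ _ _ (by simp)]
    simp [Fin.tail]

theorem contractNth_succ_cons {n : ℕ} (j : Fin (n + 1)) (x : G) (g : Fin (n + 1) → G) :
    Fin.contractNth j.succ (· * ·) (Fin.cons x g : Fin (n + 2) → G) =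
      Fin.cons x (Fin.contractNth j (· * ·) g) := by
  ext i
  refine Fin.cases ?_ (fun i => ?_) i
  · rw [Fin.contractNth_apply_of_lt _ _ _ _ (by simp)]
    simp
  · rcases lt_trichotomy (i : ℕ) j with h | h | h
    · rw [Fin.contractNth_apply_of_lt _ _ _ _ (by simpa using h)]
      simp only [Fin.castSucc_succ, Fin.cons_succ]
      rw [Fin.contractNth_apply_of_lt _ _ _ _ h]
    · rw [Fin.contractNth_apply_of_eq _ _ _ _ (by simpa using h)]
      simp only [Fin.castSucc_succ, Fin.cons_succ]
      rw [Fin.contractNth_apply_of_eq _ _ _ _ h]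
    · rw [Fin.contractNth_apply_of_gt _ _ _ _ (by simpa using h)]
      simp only [Fin.cons_succ]
      rw [Fin.contractNth_apply_of_gt _ _ _ _ h]

theorem faceSum_cons {n : ℕ} (c : (Fin (n + 1) → G) → V) (x : G) (g : Fin (n + 1) → G) :
    faceSum R c (Fin.cons x g) =
      -c (Fin.cons (x * g 0) (Fin.tail g)) - faceSum R (fun a => c (Fin.cons x a)) g := by
  rw [faceSum, Fin.sum_univ_succ, contractNth_zero_cons]
  simp only [contractNth_succ_cons, faceSum]
  simp [pow_succ, Finset.sum_neg_distrib, sub_eq_add_neg]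

theorem cobd_cons (ρ : Representation R G V) {n : ℕ} (c : (Fin (n + 1) → G) → V) (x : G)
    (g : Fin (n + 1) → G) :
    cobd ρ c (Fin.cons x g) = ρ x (c g) - c (Fin.cons (x * g 0) (Fin.tail g)) -
      faceSum R (fun a => c (Fin.cons x a)) g := by
  rw [cobd, faceSum_cons]
  simp only [Fin.cons_zero, Fin.tail_cons]
  abel

theorem faceSum_comp (L : V →ₗ[R] W) {n : ℕ} (c : (Fin n → G) → V) (g : Fin (n + 1) → G) :
    faceSum R (fun a => L (c a)) g = L (faceSum R c g) := by
  simp [faceSum]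

theorem cobd_comp (ρ : Representation R G V) (σ : Representation R G W) (L : V →ₗ[R] W)
    (hL : ∀ g v, L (ρ g v) = σ g (L v)) {n : ℕ} (c : (Fin n → G) → V) (g : Fin (n + 1) → G) :
    cobd σ (fun a => L (c a)) g = L (cobd ρ c g) := by
  rw [cobd, cobd, map_add, faceSum_comp, hL]

theorem faceSum_pullback {G' : Type} [Group G'] (f : G' →* G) {n : ℕ} (c : (Fin n → G) → V)
    (g : Fin (n + 1) → G') :
    faceSum R (fun a : Fin n → G' => c (f ∘ a)) g = faceSum R c (f ∘ g) := by
  simp only [faceSum]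
  refine Finset.sum_congr rfl fun j _ => ?_
  rw [Fin.comp_contractNth _ (· * ·) (map_mul f)]

theorem faceSum_add {n : ℕ} (c c' : (Fin n → G) → V) (g : Fin (n + 1) → G) :
    faceSum R (c + c') g = faceSum R c g + faceSum R c' g := by
  simp [faceSum, Finset.sum_add_distrib]

theorem faceSum_neg {n : ℕ} (c : (Fin n → G) → V) (g : Fin (n + 1) → G) :
    faceSum R (-c) g = -faceSum R c g := by
  simp [faceSum]

theorem cobd_add (ρ : Representation R G V) {n : ℕ} (c c' : (Fin n → G) → V) :
    cobd ρ (c + c') = cobd ρ c + cobd ρ c' := by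
  ext g
  simp only [cobd, faceSum_add, Pi.add_apply, map_add]
  abel

theorem cobd_neg (ρ : Representation R G V) {n : ℕ} (c : (Fin n → G) → V) :
    cobd ρ (-c) = -cobd ρ c := by
  ext g
  simp only [cobd, faceSum_neg, Pi.neg_apply, map_neg]
  abel

theorem cobd_sub (ρ : Representation R G V) {n : ℕ} (c c' : (Fin n → G) → V) :
    cobd ρ (c - c') = cobd ρ c - cobd ρ c' := by
  rw [sub_eq_add_neg, cobd_add, cobd_neg, sub_eq_add_neg]

/-- The cup product `(g_0, g_1, …) ↦ B(e(g_0), g_0 c(g_1, …))` of a `1`-cochain `e` and a cochain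
`c` along a pairing `B`. -/
def cup (B : X →ₗ[R] V →ₗ[R] W) (ρ : Representation R G V) (e : G → X) {n : ℕ}
    (c : (Fin n → G) → V) (g : Fin (n + 1) → G) : W :=
  B (e (g 0)) (ρ (g 0) (c (Fin.tail g)))

theorem cup_cons (B : X →ₗ[R] V →ₗ[R] W) (ρ : Representation R G V) (e : G → X) {n : ℕ}
    (c : (Fin n → G) → V) (x : G) (g : Fin n → G) :
    cup B ρ e c (Fin.cons x g) = B (e x) (ρ x (c g)) := by
  simp [cup]

theorem cup_add (B : X →ₗ[R] V →ₗ[R] W) (ρ : Representation R G V) (e : G → X) {n : ℕ}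
    (c c' : (Fin n → G) → V) : cup B ρ e (c + c') = cup B ρ e c + cup B ρ e c' := by
  ext g
  simp [cup]

/-- The Leibniz rule for the cup product with a `1`-cochain along an equivariant pairing. -/
theorem cobd_cup_cons_cons (B : X →ₗ[R] V →ₗ[R] W) (χ : Representation R G X)
    (ρ : Representation R G V) (σ : Representation R G W)
    (hB : ∀ g x v, σ g (B x v) = B (χ g x) (ρ g v)) (e : G → X) {n : ℕ}
    (c : (Fin n → G) → V) (x y : G) (g : Fin n → G) :
    cobd σ (cup B ρ e c) (Fin.cons x (Fin.cons y g)) =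
      B (χ x (e y) - e (x * y) + e x) (ρ (x * y) (c g)) -
        B (e x) (ρ x (cobd ρ c (Fin.cons y g))) := by
  have h := faceSum_comp (R := R) ((B (e x)).comp (ρ x)) c (Fin.cons y g)
  simp only [LinearMap.comp_apply] at h
  rw [cobd_cons, cup_cons, hB]
  simp only [cup_cons, Fin.cons_zero, Fin.tail_cons, cobd, h, map_add, map_sub, map_mul,
    Module.End.mul_apply, LinearMap.add_apply, LinearMap.sub_apply]
  abel

theorem cobd_cup (B : X →ₗ[R] V →ₗ[R] W) (χ : Representation R G X)
    (ρ : Representation R G V) (σ : Representation R G W)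
    (hB : ∀ g x v, σ g (B x v) = B (χ g x) (ρ g v)) (e : G → X)
    (he : ∀ x y, e (x * y) = e x + χ x (e y)) {n : ℕ} (c : (Fin n → G) → V) :
    cobd σ (cup B ρ e c) = -cup B ρ e (cobd ρ c) := by
  ext g
  rw [← Fin.cons_self_tail g, ← Fin.cons_self_tail (Fin.tail g),
    cobd_cup_cons_cons B χ ρ σ hB, he, Pi.neg_apply, cup_cons]
  simp

end Cochains

/-! ### Derivations on free groups -/

section FreeDerivations

variable {R α M : Type} [CommRing R] [AddCommGroup M] [Module R M]

/-- A derivation on a free group may be prescribed on the basis: the affine maps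
`x ↦ ρ(a_i) x + m_i` define an action of the free group, and the derivation is the orbit map
of `0`. -/
theorem exists_derivation (ρ : Representation R (FreeGroup α) M) (m : α → M) :
    ∃ D : FreeGroup α → M, (∀ a b, D (a * b) = D a + ρ a (D b)) ∧
      ∀ i, D (FreeGroup.of i) = m i := by
  let P : α → Equiv.Perm M := fun i =>
    { toFun := fun x => ρ (FreeGroup.of i) x + m i
      invFun := fun x => ρ (FreeGroup.of i)⁻¹ (x - m i)
      left_inv := fun x => by simp
      right_inv := fun x => by simp }
  let T := FreeGroup.lift P
  have hof : ∀ i x, T (FreeGroup.of i) x = ρ (FreeGroup.of i) x + m i := fun i x => by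
    simp [T, P]
  have hT : ∀ γ x, T γ x = ρ γ x + T γ 0 := by
    intro γ
    induction γ using FreeGroup.induction_on with
    | C1 => simp
    | of i => simp [hof]
    | inv_of i _ =>
      intro x
      have h : ∀ x, (T (FreeGroup.of i))⁻¹ x = ρ (FreeGroup.of i)⁻¹ (x - m i) := fun x => by
        simp only [T, P, FreeGroup.lift_apply_of]
        rfl
      rw [map_inv, h, h, ← map_add]
      congr 1
      abel
    | mul a b ha hb =>
      intro x
      rw [map_mul, map_mul, Equiv.Perm.mul_apply, Equiv.Perm.mul_apply, hb x, ha, ha (T b 0),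
        map_add, add_assoc]
      rfl
  refine ⟨fun γ => T γ 0, fun a b => ?_, fun i => ?_⟩
  · change T (a * b) 0 = T a 0 + ρ a (T b 0)
    rw [map_mul, Equiv.Perm.mul_apply, hT a, add_comm]
  · simp [hof]

theorem derivation_ext (ρ : Representation R (FreeGroup α) M) {D D' : FreeGroup α → M}
    (hD : ∀ a b, D (a * b) = D a + ρ a (D b)) (hD' : ∀ a b, D' (a * b) = D' a + ρ a (D' b))
    (h : ∀ i, D (FreeGroup.of i) = D' (FreeGroup.of i)) (γ : FreeGroup α) : D γ = D' γ := by
  have one : ∀ {E : FreeGroup α → M}, (∀ a b, E (a * b) = E a + ρ a (E b)) → E 1 = 0 := by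
    intro E hE
    simpa using hE 1 1
  have inv : ∀ {E : FreeGroup α → M}, (∀ a b, E (a * b) = E a + ρ a (E b)) →
      ∀ a, E a⁻¹ = -ρ a⁻¹ (E a) := by
    intro E hE a
    have := hE a⁻¹ a
    rw [inv_mul_cancel, one hE] at this
    exact eq_neg_of_add_eq_zero_left this.symm
  induction γ using FreeGroup.induction_on with
  | C1 => rw [one hD, one hD']
  | of i => exact h i
  | inv_of i hi => rw [inv hD, inv hD', hi]
  | mul a b ha hb => rw [hD, hD', ha, hb]

end FreeDerivations

/-! ### Dimension shifting -/

section DimensionShift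

variable {R G V : Type} [CommRing R] [Group G] [AddCommGroup V] [Module R V]

/-- The action of `G` on the functions `G → V` by right translation of the argument. -/
def translation (R G V : Type) [CommRing R] [Group G] [AddCommGroup V] [Module R V] :
    Representation R G (G → V) where
  toFun g := LinearMap.funLeft R V (· * g)
  map_one' := by ext; simp [LinearMap.funLeft]
  map_mul' g h := by ext; simp [LinearMap.funLeft, mul_assoc]

theorem translation_apply (g : G) (j : G → V) (x : G) : translation R G V g j x = j (x * g) := rfl

/-- The equivariant embedding of `V` into the functions `G → V` by orbit maps. -/
def orbitMap (ρ : Representation R G V) : V →ₗ[R] G → V :=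
  LinearMap.pi fun x => ρ x

theorem orbitMap_apply (ρ : Representation R G V) (v : V) (x : G) : orbitMap ρ v x = ρ x v := rfl

theorem orbitMap_equivariant (ρ : Representation R G V) (g : G) (v : V) :
    orbitMap ρ (ρ g v) = translation R G V g (orbitMap ρ v) := by
  ext x
  simp [orbitMap_apply, translation_apply]

theorem orbitMap_injective (ρ : Representation R G V) : Function.Injective (orbitMap ρ) := by
  intro v w h
  simpa [orbitMap_apply] using congrFun h 1

/-- The cokernel of the embedding `V → (G → V)` by orbit maps; its cohomology is that of `V`
shifted by one degree. -/
abbrev Shift (ρ : Representation R G V) : Type := (G → V) ⧸ LinearMap.range (orbitMap ρ)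

/-- The action of `G` on the cokernel of the embedding `V → (G → V)`. -/
def shift (ρ : Representation R G V) : Representation R G (Shift ρ) :=
  (translation R G V).quotient (LinearMap.range (orbitMap ρ)) (by
    rintro g _ ⟨v, rfl⟩
    exact ⟨ρ g v, orbitMap_equivariant ρ g v⟩)

/-- The projection of the functions `G → V` onto the cokernel of the embedding of `V`. -/
abbrev toShift (ρ : Representation R G V) : (G → V) →ₗ[R] Shift ρ :=
  (LinearMap.range (orbitMap ρ)).mkQ

theorem shift_toShift (ρ : Representation R G V) (g : G) (j : G → V) :
    shift ρ g (toShift ρ j) = toShift ρ (translation R G V g j) := rfl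

theorem toShift_eq_toShift (ρ : Representation R G V) {j k : G → V} :
    toShift ρ j = toShift ρ k ↔ ∃ v, orbitMap ρ v = j - k :=
  Submodule.Quotient.eq _

/-- Moving the first argument of a cochain into the argument of a function on `G` is a
contracting homotopy for cochains with values in functions. -/
theorem cobd_translation (ρ : Representation R G V) {n : ℕ} (c : (Fin (n + 1) → G) → V)
    (g : Fin (n + 1) → G) (x : G) :
    cobd (translation R G V) (fun g x => c (Fin.cons x g)) g x =
      orbitMap ρ (c g) x - cobd ρ c (Fin.cons x g) := by
  have h := faceSum_comp (R := R) (LinearMap.proj (R := R) (φ := fun _ : G => V) x)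
    (fun g x => c (Fin.cons x g)) g
  simp only [LinearMap.proj_apply] at h
  rw [cobd_cons, cobd, Pi.add_apply, translation_apply, ← h, orbitMap_apply]
  abel

end DimensionShift

/-! ### Extensions with free kernel -/

section Inflation

variable {R α A V : Type} [CommRing R] [Group A] {φ : A →* MulAut (FreeGroup α)}
  [AddCommGroup V] [Module R V]

open SemidirectProduct

/-- Vanishing of the first cohomology of the free normal subgroup: every derivation is
principal. -/
def FreeH1Vanishes (ρ : Representation R (FreeGroup α ⋊[φ] A) V) : Prop :=
  ∀ D : FreeGroup α → V, (∀ a b, D (a * b) = D a + ρ (inl a) (D b)) →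
    ∃ v, ∀ a, D a = ρ (inl a) v - v

/-- The free normal subgroup fixes `v`. -/
def FreeInvariant (ρ : Representation R (FreeGroup α ⋊[φ] A) V) (v : V) : Prop :=
  ∀ a, ρ (inl a) v = v

theorem inr_mul_inl_conj (x : FreeGroup α ⋊[φ] A) :
    inr x.right * inl (φ x.right⁻¹ x.left) = x := by
  ext <;> simp

theorem FreeInvariant.apply_eq {ρ : Representation R (FreeGroup α ⋊[φ] A) V} {v : V}
    (hv : FreeInvariant ρ v) (x : FreeGroup α ⋊[φ] A) : ρ x v = ρ (inr x.right) v := by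
  conv_lhs => rw [← inr_mul_inl_conj x, map_mul, Module.End.mul_apply, hv]

theorem FreeInvariant.add {ρ : Representation R (FreeGroup α ⋊[φ] A) V} {v w : V}
    (hv : FreeInvariant ρ v) (hw : FreeInvariant ρ w) : FreeInvariant ρ (v + w) := fun a => by
  rw [map_add, hv, hw]

theorem FreeInvariant.sub {ρ : Representation R (FreeGroup α ⋊[φ] A) V} {v w : V}
    (hv : FreeInvariant ρ v) (hw : FreeInvariant ρ w) : FreeInvariant ρ (v - w) := fun a => by
  rw [map_sub, hv, hw]

theorem FreeInvariant.apply_inr {ρ : Representation R (FreeGroup α ⋊[φ] A) V} {v : V}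
    (hv : FreeInvariant ρ v) (b : A) : FreeInvariant ρ (ρ (inr b) v) := fun a => by
  rw [← Module.End.mul_apply, ← map_mul, hv.apply_eq]
  simp

theorem FreeInvariant.cobd {ρ : Representation R (FreeGroup α ⋊[φ] A) V} {n : ℕ}
    {c : (Fin n → A) → V} (hc : ∀ a, FreeInvariant ρ (c a)) (a : Fin (n + 1) → A) :
    FreeInvariant ρ (cobd (ρ.comp inr) c a) := by
  refine FreeInvariant.add ((hc _).apply_inr _) fun b => ?_
  rw [← faceSum_comp]
  simp only [hc _ b]

theorem cobd_inflate {ρ : Representation R (FreeGroup α ⋊[φ] A) V} {n : ℕ}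
    {c : (Fin n → A) → V} (hc : ∀ a, FreeInvariant ρ (c a))
    (g : Fin (n + 1) → FreeGroup α ⋊[φ] A) :
    cobd ρ (fun g => c (rightHom ∘ g)) g = cobd (ρ.comp inr) c (rightHom ∘ g) := by
  rw [cobd, cobd, faceSum_pullback, (hc _).apply_eq]
  rfl

/-- First cohomology of a free group is right exact in the coefficients, since derivations may
be prescribed on a basis, and functions on the whole group are acyclic. -/
theorem freeH1Vanishes_shift (ρ : Representation R (FreeGroup α ⋊[φ] A) V) :
    FreeH1Vanishes (shift ρ) := by
  intro D hD
  -- Lift the derivation to functions on the group by lifting its values on the basis.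
  choose m hm using fun i => Submodule.mkQ_surjective _ (D (FreeGroup.of i))
  obtain ⟨E, hE, hEm⟩ := exists_derivation ((translation R (FreeGroup α ⋊[φ] A) V).comp inl) m
  have hED : ∀ γ, toShift ρ (E γ) = D γ := by
    refine derivation_ext ((shift ρ).comp inl) (fun a b => ?_) hD fun i => ?_
    · rw [hE, map_add]
      rfl
    · rw [hEm, hm]
  -- The lift is principal: spread it over the group along the cosets `inr a * inl γ`.
  refine ⟨toShift ρ fun x => E (φ x.right⁻¹ x.left) (inr x.right), fun γ => ?_⟩
  rw [shift_toShift, ← map_sub, ← hED]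
  congr 1
  ext x
  have h : φ (x * inl γ).right⁻¹ (x * inl γ).left = φ x.right⁻¹ x.left * γ := by
    simp [map_mul]
  rw [Pi.sub_apply, translation_apply, h, hE, Pi.add_apply, MonoidHom.comp_apply,
    translation_apply]
  simp only [mul_right, right_inl, mul_one]
  rw [inr_mul_inl_conj, add_sub_cancel_left]

theorem exists_freeInvariant_lift {ρ : Representation R (FreeGroup α ⋊[φ] A) V}
    (hρ : FreeH1Vanishes ρ) {q : Shift ρ} (hq : FreeInvariant (shift ρ) q) :
    ∃ j, toShift ρ j = q ∧ FreeInvariant (translation R (FreeGroup α ⋊[φ] A) V) j := by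
  obtain ⟨k, rfl⟩ := Submodule.mkQ_surjective _ q
  choose D hD using fun a => (toShift_eq_toShift ρ).1 ((shift_toShift ρ _ k).symm.trans (hq a))
  obtain ⟨v, hv⟩ := hρ D fun a b => by
    apply orbitMap_injective ρ
    rw [map_add, orbitMap_equivariant, hD, hD, hD, map_sub, map_mul, map_mul,
      Module.End.mul_apply]
    abel
  refine ⟨k - orbitMap ρ v, (toShift_eq_toShift ρ).2 ⟨-v, by rw [map_neg]; abel⟩, fun a => ?_⟩
  have h := hD a
  rw [hv, map_sub, orbitMap_equivariant] at h
  rw [map_sub, ← sub_eq_zero, ← sub_eq_zero.2 h.symm]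
  abel

/-- Inflation from the quotient `A` is injective on the cohomology of the invariants as soon as
the first cohomology of the free normal subgroup vanishes; higher cohomology of the free
group does not enter, because the vanishing of the first cohomology is inherited by the
dimension shift. -/
theorem exists_freeInvariant_primitive (n : ℕ) {V : Type} [AddCommGroup V] [Module R V]
    (ρ : Representation R (FreeGroup α ⋊[φ] A) V) (hρ : FreeH1Vanishes ρ)
    (u : (Fin (n + 1) → A) → V) (hu : ∀ a, FreeInvariant ρ (u a))
    (h : (Fin n → FreeGroup α ⋊[φ] A) → V) (hh : ∀ g, cobd ρ h g = u (rightHom ∘ g)) :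
    ∃ w : (Fin n → A) → V, (∀ a, FreeInvariant ρ (w a)) ∧ cobd (ρ.comp inr) w = u := by
  have surj : ∀ {m : ℕ} (a : Fin m → A),
      (rightHom ∘ (inr ∘ a : Fin m → FreeGroup α ⋊[φ] A) : Fin m → A) = a := fun a => by
    ext; simp
  induction n generalizing V with
  | zero =>
    have h0 : ∀ g, cobd ρ h g = ρ (g 0) (h Fin.elim0) - h Fin.elim0 := fun g => by
      rw [cobd, faceSum, Fin.sum_univ_one, Subsingleton.elim (Fin.tail g) Fin.elim0,
        Subsingleton.elim (Fin.contractNth 0 _ g) Fin.elim0]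
      simp [sub_eq_add_neg]
    have u1 : u (fun _ => 1) = 0 := by
      have h1 := hh fun _ => 1
      rw [h0, map_one, Module.End.one_apply, sub_self] at h1
      rw [h1]
      rfl
    refine ⟨fun _ => h Fin.elim0, fun _ a => ?_, ?_⟩
    · have h1 := hh fun _ => inl a
      rw [h0, show (rightHom ∘ fun _ => inl a : Fin 1 → A) = fun _ => 1 from
        funext fun _ => rightHom_inl a, u1] at h1
      exact sub_eq_zero.1 h1
    · ext a
      have h1 := hh (inr ∘ a)
      rw [h0, surj] at h1
      rw [cobd, faceSum, Fin.sum_univ_one]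
      simpa [sub_eq_add_neg] using h1
  | succ n ih =>
    have du : ∀ a, cobd (ρ.comp inr) u a = 0 := fun a => by
      have h1 := congrFun (cobd_cobd ρ h) (inr ∘ a)
      rw [funext hh, cobd_inflate hu, surj] at h1
      exact h1
    -- Over functions on the group, `u` is the coboundary of `v`, and modulo `V` the inflation of
    -- `v` is the coboundary of `-K`; so the induction hypothesis applies to `v` modulo `V`.
    let v : (Fin (n + 1) → A) → FreeGroup α ⋊[φ] A → V := fun a x => u (Fin.cons x.right a)
    let K : (Fin n → FreeGroup α ⋊[φ] A) → FreeGroup α ⋊[φ] A → V := fun g x => h (Fin.cons x g)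
    have hv : ∀ a, FreeInvariant (translation R (FreeGroup α ⋊[φ] A) V) (v a) := by
      intro a γ
      ext x
      simp [translation_apply, v]
    have hvK : ∀ g, v (rightHom ∘ g) =
        orbitMap ρ (h g) - cobd (translation R (FreeGroup α ⋊[φ] A) V) K g := by
      intro g
      ext x
      rw [Pi.sub_apply, cobd_translation ρ h, hh, sub_sub_cancel]
      change u _ = u _
      congr 1
      ext i
      refine Fin.cases ?_ (fun i => ?_) i <;> simp
    have dv : ∀ a, cobd ((translation R (FreeGroup α ⋊[φ] A) V).comp inr) v a =
        orbitMap ρ (u a) := by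
      intro a
      ext x
      have h1 := faceSum_comp (R := R)
        (LinearMap.proj (R := R) (φ := fun _ : FreeGroup α ⋊[φ] A => V) x) v a
      have h2 := du (Fin.cons x.right a)
      rw [cobd_cons] at h2
      simp only [LinearMap.proj_apply] at h1
      rw [cobd, Pi.add_apply, MonoidHom.comp_apply, translation_apply, ← h1, orbitMap_apply,
        (hu a).apply_eq, ← sub_eq_zero, ← neg_eq_zero, ← h2]
      simp only [v, mul_right, right_inr, MonoidHom.comp_apply]
      abel
    obtain ⟨w, hw, hwv⟩ := ih (shift ρ) (freeH1Vanishes_shift ρ) (fun a => toShift ρ (v a))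
      (fun a γ => by rw [shift_toShift, hv]) (-fun g => toShift ρ (K g)) (fun g => by
        rw [cobd_neg, Pi.neg_apply, cobd_comp (translation R (FreeGroup α ⋊[φ] A) V) (shift ρ)
          (toShift ρ) (fun _ _ => rfl), hvK, ← map_neg]
        exact (toShift_eq_toShift ρ).2 ⟨-h g, by rw [map_neg]; abel⟩)
    -- Correcting `v` by the coboundary of an invariant lift gives a cochain with values in `V`.
    choose W hW hWinv using fun a => exists_freeInvariant_lift hρ (hw a)
    have hz : ∀ a, ∃ z, orbitMap ρ z =
        v a - cobd ((translation R (FreeGroup α ⋊[φ] A) V).comp inr) W a := fun a => by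
      rw [← toShift_eq_toShift, ← cobd_comp _ ((shift ρ).comp inr) (toShift ρ) (fun _ _ => rfl)]
      simp only [hW]
      exact (congrFun hwv a).symm
    choose z hz using hz
    refine ⟨z, fun a γ => ?_, ?_⟩
    · apply orbitMap_injective ρ
      rw [orbitMap_equivariant, hz]
      exact (hv a).sub (FreeInvariant.cobd hWinv a) γ
    · ext a
      apply orbitMap_injective ρ
      rw [← cobd_comp _ ((translation R (FreeGroup α ⋊[φ] A) V).comp inr) (orbitMap ρ)
        (fun g => orbitMap_equivariant ρ _), funext hz, ← dv]
      have h1 := cobd_sub ((translation R (FreeGroup α ⋊[φ] A) V).comp inr) v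
        (cobd ((translation R (FreeGroup α ⋊[φ] A) V).comp inr) W)
      rw [cobd_cobd, sub_zero] at h1
      exact congrFun h1 a

/-- If a coboundary on `FreeGroup α ⋊ A` depends on all arguments but the first only through
`A`, then its restriction of the first argument to the free group is a coboundary on `A` with
values in homomorphisms. -/
theorem exists_edge_primitive {n : ℕ} (ρ : Representation R (FreeGroup α ⋊[φ] A) V)
    (hρ : ∀ v, FreeInvariant ρ v) (h : (Fin (n + 1) → FreeGroup α ⋊[φ] A) → V)
    (hnorm : ∀ g, (∃ i, g i = 1) → cobd ρ h g = 0)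
    (hfil : ∀ (x : FreeGroup α ⋊[φ] A) (a b : Fin (n + 1) → FreeGroup α ⋊[φ] A),
      (∀ i, (a i).right = (b i).right) → cobd ρ h (Fin.cons x a) = cobd ρ h (Fin.cons x b)) :
    ∃ E : (Fin n → A) → FreeGroup α → V, (∀ a γ δ, E a (γ * δ) = E a γ + E a δ) ∧
      ∀ (a : Fin (n + 1) → A) (γ : FreeGroup α), cobd ρ h (Fin.cons (inl γ) (inr ∘ a)) =
        ρ (inr (a 0)) (E (Fin.tail a) (φ (a 0)⁻¹ γ)) + faceSum R (fun b => E b γ) a := by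
  set f := cobd ρ h with hf
  set τ := translation R (FreeGroup α ⋊[φ] A) V
  let v : (Fin (n + 1) → A) → FreeGroup α ⋊[φ] A → V := fun a x => f (Fin.cons x (inr ∘ a))
  have hleft : ∀ (x : FreeGroup α ⋊[φ] A) (γ : FreeGroup α)
      (g : Fin (n + 1) → FreeGroup α ⋊[φ] A),
      f (Fin.cons (x * inl γ) g) = f (Fin.cons x g) + ρ x (f (Fin.cons (inl γ) g)) := by
    intro x γ g
    have h1 : cobd ρ f (Fin.cons x (Fin.cons (inl γ) g)) = 0 := congrFun (cobd_cobd ρ h) _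
    have h2 : ∀ a, f (Fin.cons x (Fin.cons (inl γ) a)) = 0 := fun a => by
      rw [hfil x _ (Fin.cons 1 a)]
      · exact hnorm _ ⟨Fin.succ 0, by simp⟩
      · intro i
        refine Fin.cases ?_ (fun i => ?_) i <;> simp
    have h3 : f (Fin.cons x (Fin.cons (inl γ * g 0) (Fin.tail g))) = f (Fin.cons x g) := by
      refine hfil x _ _ fun i => ?_
      refine Fin.cases ?_ (fun i => ?_) i <;> simp [Fin.tail]
    rw [cobd_cons, faceSum_cons] at h1
    simp only [h2, Fin.cons_zero, Fin.tail_cons, h3] at h1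
    rw [← sub_eq_zero, ← neg_eq_zero, ← h1]
    simp only [faceSum, smul_zero, Finset.sum_const_zero]
    abel
  have hvf : ∀ g x, v (rightHom ∘ g) x = f (Fin.cons x g) := fun g x =>
    hfil x _ _ fun i => by simp
  -- Translating `v a` by the free group changes it by the orbit map of the restriction of `f`.
  have hv : ∀ a γ, τ (inl γ) (v a) - v a = orbitMap ρ (f (Fin.cons (inl γ) (inr ∘ a))) := by
    intro a γ
    ext x
    rw [Pi.sub_apply, translation_apply]
    simp only [v]
    rw [hleft, add_sub_cancel_left, orbitMap_apply]
  let K : (Fin n → FreeGroup α ⋊[φ] A) → FreeGroup α ⋊[φ] A → V := fun g x => h (Fin.cons x g)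
  have hvK : ∀ g, v (rightHom ∘ g) = orbitMap ρ (h g) - cobd τ K g := by
    intro g
    ext x
    rw [Pi.sub_apply, cobd_translation ρ h, sub_sub_cancel, hvf]
  obtain ⟨w, hw, hwv⟩ := exists_freeInvariant_primitive n (shift ρ) (freeH1Vanishes_shift ρ)
    (fun a => toShift ρ (v a)) (fun a γ => by
      rw [shift_toShift, toShift_eq_toShift]
      exact ⟨_, (hv a γ).symm⟩) (-fun g => toShift ρ (K g)) (fun g => by
      rw [cobd_neg, Pi.neg_apply, cobd_comp τ (shift ρ) (toShift ρ) (fun _ _ => rfl), hvK,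
        ← map_neg]
      exact (toShift_eq_toShift ρ).2 ⟨-h g, by rw [map_neg]; abel⟩)
  choose W hW using fun a => Submodule.mkQ_surjective _ (w a)
  -- The differences `γ W(a) - W(a)` lie in `V` and are the values of the primitive.
  choose E hE using fun a γ => (toShift_eq_toShift ρ).1
    ((shift_toShift ρ (inl γ) (W a)).symm.trans ((hW a).symm ▸ hw a γ))
  refine ⟨E, fun a γ δ => ?_, fun a γ => ?_⟩
  · apply orbitMap_injective ρ
    have h1 := congrArg (τ (inl γ)) (hE a δ)
    rw [← orbitMap_equivariant, hρ] at h1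
    rw [map_add, h1, hE, hE, map_sub, map_mul, map_mul, Module.End.mul_apply]
    abel
  · obtain ⟨z, hz⟩ : ∃ z, orbitMap ρ z = v a - cobd (τ.comp inr) W a := by
      rw [← toShift_eq_toShift, ← cobd_comp _ ((shift ρ).comp inr) (toShift ρ) (fun _ _ => rfl)]
      simp only [hW]
      exact (congrFun hwv a).symm
    have hinl : inl γ * inr (a 0) = (inr (a 0) * inl (φ (a 0)⁻¹ γ) : FreeGroup α ⋊[φ] A) := by
      ext <;> simp
    have h1 := congrArg (τ (inl γ)) hz
    rw [← orbitMap_equivariant, hρ, hz, map_sub] at h1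
    have h2 : τ (inl γ) (cobd (τ.comp inr) W a) - cobd (τ.comp inr) W a = orbitMap ρ
        (ρ (inr (a 0)) (E (Fin.tail a) (φ (a 0)⁻¹ γ)) + faceSum R (fun b => E b γ) a) := by
      rw [map_add, orbitMap_equivariant, hE, ← faceSum_comp, cobd, map_add, ← faceSum_comp]
      simp only [hE, MonoidHom.comp_apply]
      rw [← Module.End.mul_apply, ← map_mul, hinl, map_mul, Module.End.mul_apply, map_sub]
      have h3 := faceSum_add (R := R) (fun b => τ (inl γ) (W b)) (-W) a
      rw [faceSum_neg] at h3
      rw [show (fun b => τ (inl γ) (W b) - W b) = (fun b => τ (inl γ) (W b)) + -W from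
        funext fun b => sub_eq_add_neg _ _, h3]
      abel
    apply orbitMap_injective ρ
    rw [← h2, ← hv, ← sub_eq_zero, ← sub_eq_zero.2 h1.symm]
    abel

end Inflation

/-! ### Pairings of tensor powers -/

section Pairings

variable {R V W : Type} [CommRing R] [AddCommGroup V] [Module R V] [AddCommGroup W] [Module R W]

/-- The multiplication `V ⊗ V^{⊗ m} → V^{⊗ (m+1)}` of the tensor algebra, as a pairing. -/
def consMap (R V : Type) [CommRing R] [AddCommGroup V] [Module R V] (m : ℕ) :
    V →ₗ[R] (⨂[R]^m V) →ₗ[R] ⨂[R]^(m + 1) V :=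
  PiTensorProduct.lift.toLinearMap ∘ₗ
    (PiTensorProduct.tprod R : MultilinearMap R (fun _ : Fin (m + 1) => V) _).curryLeft

theorem consMap_tprod {m : ℕ} (v : V) (t : Fin m → V) :
    consMap R V m v (PiTensorProduct.tprod R t) =
      PiTensorProduct.tprod R (Fin.cons v t : Fin (m + 1) → V) := by
  simp [consMap]

theorem map_consMap (L : V →ₗ[R] W) {m : ℕ} (v : V) (t : ⨂[R]^m V) :
    PiTensorProduct.map (fun _ => L) (consMap R V m v t) =
      consMap R W m (L v) (PiTensorProduct.map (fun _ => L) t) := by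
  suffices h : PiTensorProduct.map (fun _ => L) ∘ₗ consMap R V m v =
      consMap R W m (L v) ∘ₗ PiTensorProduct.map (fun _ => L) from LinearMap.congr_fun h t
  ext t
  simp only [LinearMap.compMultilinearMap_apply, LinearMap.comp_apply, consMap_tprod,
    PiTensorProduct.map_tprod]
  congr 1
  ext i
  refine Fin.cases ?_ (fun i => ?_) i <;> simp

/-- The pairing `(v ⊗ w, f) ↦ v ⊗ f(w)` of `V ⊗ V` with `Hom(V, V^{⊗ m})`. -/
def squarePairing (R V : Type) [CommRing R] [AddCommGroup V] [Module R V] (m : ℕ) :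
    V ⊗[R] V →ₗ[R] (V →ₗ[R] ⨂[R]^m V) →ₗ[R] ⨂[R]^(m + 1) V :=
  TensorProduct.lift <| LinearMap.mk₂ R (fun v w => consMap R V m v ∘ₗ LinearMap.applyₗ w)
    (fun _ _ _ => by ext; simp) (fun _ _ _ => by ext; simp) (fun _ _ _ => by ext; simp)
    (fun _ _ _ => by ext; simp)

theorem squarePairing_tmul {m : ℕ} (v w : V) (f : V →ₗ[R] ⨂[R]^m V) :
    squarePairing R V m (v ⊗ₜ w) f = consMap R V m v (f w) := by
  simp [squarePairing]

theorem map_squarePairing (L : V →ₗ[R] W) {m : ℕ} (s : V ⊗[R] V) (f : V →ₗ[R] ⨂[R]^m V)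
    (f' : W →ₗ[R] ⨂[R]^m W) (hf : ∀ v, f' (L v) = PiTensorProduct.map (fun _ => L) (f v)) :
    PiTensorProduct.map (fun _ => L) (squarePairing R V m s f) =
      squarePairing R W m (TensorProduct.map L L s) f' := by
  induction s with
  | zero => simp
  | add s t hs ht => simp only [map_add, LinearMap.add_apply, hs, ht]
  | tmul v w => rw [squarePairing_tmul, map_consMap, TensorProduct.map_tmul, squarePairing_tmul, hf]

/-- The pairing of `Hom(V, V ⊗ V)` with `Hom(V, V^{⊗ m})` sending `(t, f)` to `(1 ⊗ f) ∘ t`. -/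
def homPairing (R V : Type) [CommRing R] [AddCommGroup V] [Module R V] (m : ℕ) :
    (V →ₗ[R] V ⊗[R] V) →ₗ[R] (V →ₗ[R] ⨂[R]^m V) →ₗ[R] (V →ₗ[R] ⨂[R]^(m + 1) V) :=
  LinearMap.mk₂ R (fun t f => (squarePairing R V m).flip f ∘ₗ t)
    (fun _ _ _ => by ext; simp) (fun _ _ _ => by ext; simp) (fun _ _ _ => by ext; simp)
    (fun _ _ _ => by ext; simp)

theorem homPairing_apply {m : ℕ} (t : V →ₗ[R] V ⊗[R] V) (f : V →ₗ[R] ⨂[R]^m V) (v : V) :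
    homPairing R V m t f v = squarePairing R V m (t v) f := by
  simp [homPairing]

variable {G : Type} [Group G]

theorem tensorPowRep_consMap (ρ : Representation R G V) {m : ℕ} (g : G) (v : V) (t : ⨂[R]^m V) :
    tensorPowRep ρ (m + 1) g (consMap R V m v t) =
      consMap R V m (ρ g v) (tensorPowRep ρ m g t) :=
  map_consMap (ρ g) v t

theorem tensorPowRep_squarePairing (ρ : Representation R G V) {m : ℕ} (g : G) (s : V ⊗[R] V)
    (f : V →ₗ[R] ⨂[R]^m V) :
    tensorPowRep ρ (m + 1) g (squarePairing R V m s f) =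
      squarePairing R V m (ρ.tprod ρ g s) (ρ.linHom (tensorPowRep ρ m) g f) :=
  map_squarePairing (ρ g) s f _ fun v => by
    rw [Representation.linHom_apply, LinearMap.comp_apply, LinearMap.comp_apply,
      Representation.inv_self_apply]
    rfl

theorem linHom_homPairing (ρ : Representation R G V) {m : ℕ} (g : G) (t : V →ₗ[R] V ⊗[R] V)
    (f : V →ₗ[R] ⨂[R]^m V) :
    ρ.linHom (tensorPowRep ρ (m + 1)) g (homPairing R V m t f) =
      homPairing R V m (ρ.linHom (ρ.tprod ρ) g t) (ρ.linHom (tensorPowRep ρ m) g f) := by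
  ext v
  rw [homPairing_apply, Representation.linHom_apply, LinearMap.comp_apply, LinearMap.comp_apply,
    homPairing_apply, tensorPowRep_squarePairing]
  rfl

theorem linHom_apply_apply (ρ : Representation R G V) (σ : Representation R G W) (g : G)
    (f : V →ₗ[R] W) (v : V) : ρ.linHom σ g f (ρ g v) = σ g (f v) := by
  rw [Representation.linHom_apply, LinearMap.comp_apply, LinearMap.comp_apply,
    Representation.inv_self_apply]

theorem cupPow_succ (ρ : Representation R G V) (k : G → V) (m : ℕ) :
    cupPow ρ k (m + 1) = cup (consMap R V m) (tensorPowRep ρ m) k (cupPow ρ k m) := by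
  ext g
  have h : tensorPowRep ρ m (g 0) (cupPow ρ k m (Fin.tail g)) =
      PiTensorProduct.tprod R fun i : Fin m =>
        ρ (g 0) (ρ (Fin.partialProd (Fin.tail g) i.castSucc) (k (Fin.tail g i))) :=
    PiTensorProduct.map_tprod _ _
  rw [cup, h, consMap_tprod, cupPow]
  congr 1
  ext i
  refine Fin.cases ?_ (fun i => ?_) i
  · simp
  · rw [Fin.cons_succ, Fin.castSucc_succ, Fin.partialProd_succ', map_mul]
    rfl

end Pairings

/-- The module `Hom(V, V ⊗ V)`. -/
abbrev SquareHom (R V : Type) [CommRing R] [AddCommGroup V] [Module R V] : Type :=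
  V →ₗ[R] V ⊗[R] V

/-- The module `Hom(V, V^{⊗ m})`. -/
abbrev PowHom (R V : Type) [CommRing R] [AddCommGroup V] [Module R V] (m : ℕ) : Type :=
  V →ₗ[R] ⨂[R]^m V

/-! ### Iterated composition products of a 1-cocycle -/

section IteratedCocycles

variable {R G V : Type} [CommRing R] [Group G] [AddCommGroup V] [Module R V]

/-- The iterated composition product of a `1`-cocycle `τ` with values in `Hom(V, V ⊗ V)`: the
`m`-cochain with values in `Hom(V, V^{⊗ (m+1)})` obtained from the identity of `V` by applying
`τ(g_0)`, then `g_0 τ(g_1)` to the last tensor factor, and so on. -/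
def iteratedCocycle (ρ : Representation R G V) (τ : G → SquareHom R V) :
    (m : ℕ) → (Fin m → G) → PowHom R V (m + 1)
  | 0 => fun _ => (consMap R V 0).flip (PiTensorProduct.tprod R Fin.elim0)
  | m + 1 => cup (homPairing R V (m + 1)) (ρ.linHom (tensorPowRep ρ (m + 1))) τ
      (iteratedCocycle ρ τ m)

theorem iteratedCocycle_succ_apply (ρ : Representation R G V) (τ : G → SquareHom R V) (m : ℕ)
    (g : Fin (m + 1) → G) (v : V) :
    iteratedCocycle ρ τ (m + 1) g v = squarePairing R V (m + 1) (τ (g 0) v)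
      (ρ.linHom (tensorPowRep ρ (m + 1)) (g 0) (iteratedCocycle ρ τ m (Fin.tail g))) :=
  homPairing_apply _ _ _

theorem iteratedCocycle_comp {G' : Type} [Group G'] (ρ : Representation R G V)
    (τ : G → SquareHom R V) (f : G' →* G) (m : ℕ) (g : Fin m → G') :
    iteratedCocycle (ρ.comp f) (τ ∘ f) m g = iteratedCocycle ρ τ m (f ∘ g) := by
  induction m with
  | zero => rfl
  | succ m ih =>
    ext1 v
    rw [iteratedCocycle_succ_apply, iteratedCocycle_succ_apply, ih, Representation.linHom_apply,
      Representation.linHom_apply, MonoidHom.comp_apply, map_inv]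
    rfl

theorem linHom_iteratedCocycle_zero (ρ : Representation R G V) (τ : G → SquareHom R V)
    (g : G) (a : Fin 0 → G) :
    ρ.linHom (tensorPowRep ρ 1) g (iteratedCocycle ρ τ 0 a) = iteratedCocycle ρ τ 0 a := by
  have h : tensorPowRep ρ 0 g (PiTensorProduct.tprod R Fin.elim0) =
      PiTensorProduct.tprod R Fin.elim0 :=
    (PiTensorProduct.map_tprod _ _).trans (congrArg _ (Subsingleton.elim _ _))
  ext v
  rw [Representation.linHom_apply, LinearMap.comp_apply, LinearMap.comp_apply]
  simp only [iteratedCocycle, LinearMap.flip_apply]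
  rw [tensorPowRep_consMap, h, Representation.self_inv_apply]

theorem cobd_iteratedCocycle (ρ : Representation R G V) (τ : G → SquareHom R V)
    (hτ : ∀ x y, τ (x * y) = τ x + ρ.linHom (ρ.tprod ρ) x (τ y)) (m : ℕ) :
    cobd (ρ.linHom (tensorPowRep ρ (m + 1))) (iteratedCocycle ρ τ m) = 0 := by
  induction m with
  | zero =>
    ext1 g
    rw [cobd, faceSum, Fin.sum_univ_one, linHom_iteratedCocycle_zero]
    simp [iteratedCocycle]
  | succ m ih =>
    rw [iteratedCocycle, cobd_cup _ (ρ.linHom (ρ.tprod ρ)) _ _ (linHom_homPairing ρ) τ hτ, ih]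
    ext1 g
    simp [cup]

theorem iteratedCocycle_eq_zero (ρ : Representation R G V) (τ : G → SquareHom R V)
    (hτ : τ 1 = 0) {m : ℕ} (g : Fin m → G) (h : ∃ i, g i = 1) : iteratedCocycle ρ τ m g = 0 := by
  induction m with
  | zero => exact h.choose.elim0
  | succ m ih =>
    obtain ⟨i, hi⟩ := h
    rw [iteratedCocycle, cup]
    induction i using Fin.cases with
    | zero => rw [hi, hτ, map_zero, LinearMap.zero_apply]
    | succ i => rw [ih _ ⟨i, hi⟩, map_zero, map_zero]

theorem iteratedCocycle_natural {G' W : Type} [Group G'] [AddCommGroup W] [Module R W]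
    (ρ : Representation R G V) (τ : G → SquareHom R V) (σ : Representation R G' W)
    (τ' : G' → SquareHom R W) (L : V →ₗ[R] W) {m : ℕ} (a : Fin m → G) (b : Fin m → G')
    (hL : ∀ i v, L (ρ (a i) v) = σ (b i) (L v))
    (hτ : ∀ i v, τ' (b i) (L v) = TensorProduct.map L L (τ (a i) v)) (v : V) :
    iteratedCocycle σ τ' m b (L v) =
      PiTensorProduct.map (fun _ => L) (iteratedCocycle ρ τ m a v) := by
  induction m generalizing v with
  | zero =>
    simp only [iteratedCocycle, LinearMap.flip_apply]
    rw [map_consMap, PiTensorProduct.map_tprod]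
    congr 2
    exact Subsingleton.elim _ _
  | succ m ih =>
    rw [iteratedCocycle_succ_apply, iteratedCocycle_succ_apply, hτ]
    refine (map_squarePairing L _ _ _ fun w => ?_).symm
    obtain ⟨w, rfl⟩ := (ρ.apply_bijective (a 0)).2 w
    rw [hL, linHom_apply_apply, linHom_apply_apply, ih (Fin.tail a) (Fin.tail b)
      (fun i => hL i.succ) (fun i => hτ i.succ)]
    exact LinearMap.congr_fun (tensorPowRep_comm ρ σ L (m + 1) (a 0) (b 0)
      (LinearMap.ext (hL 0))).symm _

/-- If `k ∪ k` is cohomologous to the evaluation of the `1`-cocycle `τ` on `k`, then the cup powers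
of `k` are cohomologous to the evaluations of the iterated products of `τ` on `k`. -/
theorem exists_cupPow_eq (ρ : Representation R G V) (k : G → V)
    (hk : ∀ g h, k (g * h) = k g + ρ g (k h)) (τ : G → SquareHom R V)
    (hτ : ∀ x y, τ (x * y) = τ x + ρ.linHom (ρ.tprod ρ) x (τ y)) (η : G → V ⊗[R] V)
    (hη : ∀ x y, ρ.tprod ρ x (η y) - η (x * y) + η x =
      ρ.linHom (ρ.tprod ρ) x (τ y) (k x) - k x ⊗ₜ ρ x (k y)) (m : ℕ) :
    ∃ e : (Fin m → G) → ⨂[R]^(m + 1) V, cupPow ρ k (m + 1) =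
      cup LinearMap.applyₗ (ρ.linHom (tensorPowRep ρ (m + 1))) k (iteratedCocycle ρ τ m) +
        cobd (tensorPowRep ρ (m + 1)) e := by
  induction m with
  | zero =>
    refine ⟨0, ?_⟩
    ext1 g
    rw [cupPow_succ, Pi.add_apply, cup, cup, linHom_iteratedCocycle_zero, cobd, faceSum]
    simp only [iteratedCocycle, LinearMap.applyₗ_apply_apply, LinearMap.flip_apply, Pi.zero_apply,
      map_zero, smul_zero, Finset.sum_const_zero, add_zero]
    congr 1
    refine (PiTensorProduct.map_tprod _ _).trans (congrArg _ (Subsingleton.elim _ _))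
  | succ m ih =>
    obtain ⟨e, he⟩ := ih
    have h1 := cobd_cup (consMap R V (m + 1)) ρ (tensorPowRep ρ (m + 1))
      (tensorPowRep ρ (m + 1 + 1)) (tensorPowRep_consMap ρ) k hk e
    refine ⟨-(cup (squarePairing R V (m + 1)) (ρ.linHom (tensorPowRep ρ (m + 1))) η
      (iteratedCocycle ρ τ m) + cup (consMap R V (m + 1)) (tensorPowRep ρ (m + 1)) k e), ?_⟩
    rw [cupPow_succ, he, cup_add, cobd_neg, cobd_add, h1, neg_add, neg_neg, ← add_assoc]
    congr 1
    rw [eq_add_neg_iff_add_eq]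
    ext g
    rw [← Fin.cons_self_tail g, ← Fin.cons_self_tail (Fin.tail g), Pi.add_apply,
      cobd_cup_cons_cons _ (ρ.tprod ρ) _ _ (tensorPowRep_squarePairing ρ), hη,
      cobd_iteratedCocycle ρ τ hτ]
    simp only [cup_cons, LinearMap.applyₗ_apply_apply, iteratedCocycle, linHom_homPairing,
      homPairing_apply, Pi.zero_apply, map_zero, sub_zero, map_sub, LinearMap.sub_apply, map_mul,
      Module.End.mul_apply, squarePairing_tmul, linHom_apply_apply]
    abel

end IteratedCocycles

/-! ### Linear maps on the abelianization -/

section Homology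

variable {n : ℕ} {M : Type} [AddCommGroup M] [Module ℤ M]

theorem cls_mul (γ δ : F n) : cls (γ * δ) = cls γ + cls δ := rfl

/-- The linear map on `H` induced by an additive function on the free group. -/
def hLift (D : F n → M) (hD : ∀ γ δ, D (γ * δ) = D γ + D δ) : H n →ₗ[ℤ] M :=
  let L : H n →+ M := MonoidHom.toAdditiveLeft (Abelianization.lift
    (MonoidHom.mk' (fun γ => Multiplicative.ofAdd (D γ)) hD))
  { L with map_smul' := fun r v => by simpa using map_intCast_smul L ℤ ℤ r v }

theorem additive_ext {D D' : F n → M} (hD : ∀ γ δ, D (γ * δ) = D γ + D δ)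
    (hD' : ∀ γ δ, D' (γ * δ) = D' γ + D' δ)
    (h : ∀ i, D (FreeGroup.of i) = D' (FreeGroup.of i)) (γ : F n) : D γ = D' γ :=
  derivation_ext (1 : Representation ℤ (F n) M) hD hD' h γ

theorem hom_H_ext {L L' : H n →ₗ[ℤ] M}
    (h : ∀ i, L (cls (FreeGroup.of i)) = L' (cls (FreeGroup.of i))) : L = L' := by
  refine LinearMap.ext fun v => ?_
  obtain ⟨γ, rfl⟩ := cls_surjective v
  exact additive_ext (D := fun γ => L (cls γ)) (D' := fun γ => L' (cls γ))
    (fun γ δ => by rw [cls_mul, map_add]) (fun γ δ => by rw [cls_mul, map_add]) h γ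

/-- The basis of `H` given by the letters. -/
def hBasis (n : ℕ) : Module.Basis (Fin n) ℤ (H n) :=
  Module.Basis.ofRepr
    { (FreeAbelianGroup.equivFinsupp (Fin n)).toIntLinearEquiv with }

instance : Module.Free ℤ (H n) := Module.Free.of_basis (hBasis n)

instance : Module.Finite ℤ (H n) := Module.Finite.of_basis (hBasis n)

end Homology

/-! ### The quadratic part of the Magnus expansion -/

section Magnus

variable {m n : ℕ}

/-- A map with the product rule of the quadratic part of a Magnus expansion is, together with the
linear part `c`, a derivation with values in a unipotent module. -/
theorem exists_quadratic {R α V : Type} [CommRing R] [AddCommGroup V] [Module R V]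
    (c : FreeGroup α → V) (hc : ∀ γ δ, c (γ * δ) = c γ + c δ) : ∃ θ : FreeGroup α → V ⊗[R] V,
    (∀ γ δ, θ (γ * δ) = θ γ + θ δ + c γ ⊗ₜ c δ) ∧ ∀ i, θ (FreeGroup.of i) = 0 := by
  have hc1 : c 1 = 0 := by simpa using hc 1 1
  let ρ : Representation R (FreeGroup α) (V × V ⊗[R] V) :=
    { toFun := fun γ => LinearMap.prod (LinearMap.fst R _ _)
        (LinearMap.snd R _ _ + TensorProduct.mk R _ _ (c γ) ∘ₗ LinearMap.fst R _ _)
      map_one' := by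
        refine LinearMap.ext fun x => ?_
        refine Prod.ext rfl ?_
        simp [hc1]
      map_mul' := fun γ δ => by
        refine LinearMap.ext fun x => ?_
        refine Prod.ext rfl ?_
        change x.2 + c (γ * δ) ⊗ₜ x.1 = (x.2 + c δ ⊗ₜ x.1) + c γ ⊗ₜ x.1
        rw [hc, TensorProduct.add_tmul]
        abel }
  have hρ : ∀ γ x, ρ γ x = (x.1, x.2 + c γ ⊗ₜ x.1) := fun _ _ => rfl
  obtain ⟨D, hD, hDi⟩ := exists_derivation ρ fun i => (c (FreeGroup.of i), 0)
  have h1 : ∀ γ, (D γ).1 = c γ := derivation_ext (1 : Representation R (FreeGroup α) V)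
    (fun γ δ => by rw [hD, hρ]; rfl) hc (fun i => by rw [hDi])
  refine ⟨fun γ => (D γ).2, fun γ δ => ?_, fun i => congrArg Prod.snd (hDi i)⟩
  simp only [hD, hρ, h1, Prod.snd_add]
  abel

/-- The quadratic part of the standard Magnus expansion `x_i ↦ 1 + X_i` of the free group. -/
def magnus (n : ℕ) : F n → H n ⊗[ℤ] H n := (exists_quadratic cls cls_mul).choose

theorem magnus_mul (γ δ : F n) :
    magnus n (γ * δ) = magnus n γ + magnus n δ + cls γ ⊗ₜ cls δ :=
  (exists_quadratic (R := ℤ) (cls (n := n)) cls_mul).choose_spec.1 γ δ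

theorem magnus_of (i : Fin n) : magnus n (FreeGroup.of i) = 0 :=
  (exists_quadratic (R := ℤ) (cls (n := n)) cls_mul).choose_spec.2 i

theorem magnus_natural (f : F m →* F n) (hf : ∀ i, magnus n (f (FreeGroup.of i)) = 0) (γ : F m) :
    magnus n (f γ) = TensorProduct.map (hMap f) (hMap f) (magnus m γ) := by
  rw [← sub_eq_zero]
  refine additive_ext (D := fun γ => magnus n (f γ) - TensorProduct.map (hMap f) (hMap f)
    (magnus m γ)) (D' := fun _ => 0) (fun γ δ => ?_) (fun _ _ => (add_zero 0).symm)
    (fun i => ?_) γ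
  · simp only [map_mul, magnus_mul, map_add, TensorProduct.map_tmul, hMap_cls]
    abel
  · simp only [hf, magnus_of, map_zero, sub_zero]

theorem tprod_hRep_tmul (b : A n) (γ δ : F n) :
    ((hRep n).tprod (hRep n)) b (cls γ ⊗ₜ cls δ) = cls (b γ) ⊗ₜ cls (b δ) := rfl

/-- The `1`-cocycle on `Aut(F_n)` with values in `Hom(H, H ⊗ H)` which, up to sign, extends the first
Johnson homomorphism by means of the quadratic part `θ` of the standard Magnus expansion: its value
at `b` is the homomorphism `[γ] ↦ θ(γ) - b θ(b⁻¹ γ)`. -/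
def johnson (b : A n) : SquareHom ℤ (H n) :=
  hLift (fun γ => magnus n γ - (hRep n).tprod (hRep n) b (magnus n (b⁻¹ γ))) fun γ δ => by
    simp only [map_mul, magnus_mul, map_add, tprod_hRep_tmul, MulAut.apply_inv_self]
    abel

theorem johnson_cls (b : A n) (γ : F n) : johnson b (cls γ) =
    magnus n γ - (hRep n).tprod (hRep n) b (magnus n (b⁻¹ γ)) := rfl

theorem hRep_cls (b : A n) (γ : F n) : hRep n b (cls γ) = cls (b γ) := rfl

theorem linHom_johnson_cls (a b : A n) (γ : F n) :
    (hRep n).linHom ((hRep n).tprod (hRep n)) a (johnson b) (cls γ) =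
      (hRep n).tprod (hRep n) a (magnus n (a⁻¹ γ)) -
        (hRep n).tprod (hRep n) (a * b) (magnus n (b⁻¹ (a⁻¹ γ))) := by
  rw [Representation.linHom_apply, LinearMap.comp_apply, LinearMap.comp_apply, hRep_cls,
    johnson_cls, map_sub, map_mul, Module.End.mul_apply]

theorem johnson_mul (a b : A n) : johnson (a * b) =
    johnson a + (hRep n).linHom ((hRep n).tprod (hRep n)) a (johnson b) := by
  refine LinearMap.ext fun v => ?_
  obtain ⟨γ, rfl⟩ := cls_surjective v
  rw [LinearMap.add_apply, linHom_johnson_cls, johnson_cls, johnson_cls, mul_inv_rev,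
    MulAut.mul_apply]
  abel

theorem johnson_one : johnson (1 : A n) = 0 := by
  simpa using johnson_mul (1 : A n) 1

theorem johnson_natural (f : F m →* F n) (hf : ∀ i, magnus n (f (FreeGroup.of i)) = 0)
    (a : A m) (b : A n) (hab : ∀ γ, f (a γ) = b (f γ)) (v : H m) :
    johnson b (hMap f v) = TensorProduct.map (hMap f) (hMap f) (johnson a v) := by
  obtain ⟨γ, rfl⟩ := cls_surjective v
  have hinv : b⁻¹ (f γ) = f (a⁻¹ γ) := by
    have h : f γ = b (f (a⁻¹ γ)) := by rw [← hab, MulAut.apply_inv_self]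
    rw [h, MulAut.inv_apply_self]
  have hcomm : hMap f ∘ₗ hRep m a = hRep n b ∘ₗ hMap f := LinearMap.ext fun w => by
    obtain ⟨δ, rfl⟩ := cls_surjective w
    exact congrArg cls (hab δ)
  rw [hMap_cls, johnson_cls, johnson_cls, hinv, map_sub, magnus_natural f hf, magnus_natural f hf,
    Representation.tprod_apply, Representation.tprod_apply, ← LinearMap.comp_apply,
    ← LinearMap.comp_apply, ← TensorProduct.map_comp, ← TensorProduct.map_comp, hcomm]

/-- The explicit cochain on `Aut(F_n)` with values in `Hom(H, H^{⊗ (p+1)})` that represents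
`h_p`. -/
def hCochain (n p : ℕ) : (Fin p → A n) → PowHom ℤ (H n) (p + 1) :=
  iteratedCocycle (hRep n) johnson p

/-- On `F_n ⋊ Aut(F_n)` the cup powers of `k_0` are cohomologous to the evaluations of the explicit
cochains on `k_0`. -/
theorem exists_cupPow_k0_eq (n p : ℕ) : ∃ e : (Fin p → Abar n) → ⨂[ℤ]^(p + 1) (H n),
    cupPow ((hRep n).comp (proj n)) (k0 n) (p + 1) =
      cup LinearMap.applyₗ
        (Representation.linHom ((hRep n).comp (proj n)) (tensorPowRep ((hRep n).comp (proj n)) (p + 1)))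
        (k0 n) (fun g => hCochain n p (proj n ∘ g)) +
      cobd (tensorPowRep ((hRep n).comp (proj n)) (p + 1)) e := by
  have hlin : ∀ (x : Abar n) (t : SquareHom ℤ (H n)),
      Representation.linHom ((hRep n).comp (proj n))
        (Representation.tprod ((hRep n).comp (proj n)) ((hRep n).comp (proj n))) x t =
      (hRep n).linHom ((hRep n).tprod (hRep n)) (proj n x) t := fun x t => by
    rw [Representation.linHom_apply, Representation.linHom_apply, ← map_inv]
    rfl
  have h := exists_cupPow_eq ((hRep n).comp (proj n)) (k0 n) (k0_mul n) (johnson ∘ proj n)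
    (fun x y => by
      rw [hlin, Function.comp_apply, map_mul, johnson_mul]
      rfl)
    -- Twisting `θ` by `φ` makes the coboundary depend on `γ` through the first argument only.
    (fun x => (hRep n).tprod (hRep n) x.right (magnus n (x.right⁻¹ x.left)))
    (fun x y => by
      rw [hlin]
      have e1 : (x * y).right⁻¹ (x * y).left =
          y.right⁻¹ (x.right⁻¹ x.left) * y.right⁻¹ y.left := by
        simp [mul_inv_rev]
      have e2 : ((hRep n).tprod (hRep n)) (x.right * y.right)
          (cls (y.right⁻¹ (x.right⁻¹ x.left)) ⊗ₜ cls (y.right⁻¹ y.left)) =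
          k0 n x ⊗ₜ ((hRep n).comp (proj n)) x (k0 n y) := by
        rw [tprod_hRep_tmul]
        simp only [MulAut.mul_apply, MulAut.apply_inv_self]
        rfl
      have e3 : (Representation.tprod ((hRep n).comp (proj n)) ((hRep n).comp (proj n))) x
          ((hRep n).tprod (hRep n) y.right (magnus n (y.right⁻¹ y.left))) =
          (hRep n).tprod (hRep n) (x.right * y.right) (magnus n (y.right⁻¹ y.left)) := by
        rw [map_mul]
        rfl
      have e4 : (hRep n).linHom ((hRep n).tprod (hRep n)) (proj n x) ((johnson ∘ proj n) y)
          (k0 n x) = (hRep n).tprod (hRep n) x.right (magnus n (x.right⁻¹ x.left)) -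
            (hRep n).tprod (hRep n) (x.right * y.right)
              (magnus n (y.right⁻¹ (x.right⁻¹ x.left))) :=
        linHom_johnson_cls _ _ _
      rw [e1, magnus_mul, SemidirectProduct.mul_right, map_add, map_add, e2, e3, e4]
      abel) p
  simp only [funext (iteratedCocycle_comp (hRep n) johnson (proj n) p)] at h
  exact h

end Magnus

/-! ### Cohomology classes of explicit cocycles -/

section Classes

variable {R G : Type} [CommRing R] [Group G]

theorem iCocycles_injective (M : Rep.{0} R G) (m : ℕ) :
    Function.Injective (groupCohomology.iCocycles M m) :=
  (ModuleCat.mono_iff_injective _).1 inferInstance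

/-- Classes of cocycles agree exactly when the cocycles differ by a coboundary. -/
theorem π_eq_iff (M : Rep.{0} R G) (m : ℕ) (x y : groupCohomology.cocycles M (m + 1)) :
    groupCohomology.π M (m + 1) x = groupCohomology.π M (m + 1) y ↔
      ∃ h : (Fin m → G) → M.V, (groupCohomology.iCocycles M (m + 1) x -
        groupCohomology.iCocycles M (m + 1) y : (Fin (m + 1) → G) → M.V) = cobd M.ρ h := by
  have hi : ∀ h : (Fin m → G) → M.V, groupCohomology.iCocycles M (m + 1)
      (groupCohomology.toCocycles M m (m + 1) h) = cobd M.ρ h := fun h => by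
    rw [← d_eq_cobd, ← groupCohomology.inhomogeneousCochains.d_def, ← ConcreteCategory.comp_apply,
      HomologicalComplex.toCycles_i]
  have hex : (ShortComplex.mk _ _ ((groupCohomology.inhomogeneousCochains M).toCycles_comp_homologyπ
      m (m + 1))).Exact :=
    ShortComplex.exact_of_g_is_cokernel _
      ((groupCohomology.inhomogeneousCochains M).homologyIsCokernel m (m + 1) (by simp))
  rw [← sub_eq_zero, ← map_sub]
  constructor
  · intro h
    obtain ⟨e, he⟩ := (ShortComplex.moduleCat_exact_iff _).1 hex _ h
    refine ⟨e, ?_⟩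
    rw [← hi, ← map_sub]
    exact congrArg _ he.symm
  · rintro ⟨e, he⟩
    have : x - y = groupCohomology.toCocycles M m (m + 1) e := iCocycles_injective M _ (by rw [hi, map_sub]; exact he)
    rw [this, ← ConcreteCategory.comp_apply]
    erw [(groupCohomology.inhomogeneousCochains M).toCycles_comp_homologyπ m (m + 1)]
    rfl

theorem π_cocyclesMk_eq (M : Rep.{0} R G) {m : ℕ} {f f' : (Fin (m + 1) → G) → M.V}
    (hf : inhomogeneousCochains.d M (m + 1) f = 0) (hf' : inhomogeneousCochains.d M (m + 1) f' = 0)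
    (e : (Fin m → G) → M.V) (he : f - f' = cobd M.ρ e) :
    groupCohomology.π M (m + 1) (groupCohomology.cocyclesMk f hf) =
      groupCohomology.π M (m + 1) (groupCohomology.cocyclesMk f' hf') :=
  (π_eq_iff _ _ _ _).2 ⟨e, by
    rw [groupCohomology.iCocycles_mk, groupCohomology.iCocycles_mk]
    exact he⟩

theorem iCocycles_cocyclesMap {G' : Type} [Group G'] {M : Rep.{0} R G} {N : Rep.{0} R G'}
    (f : G' →* G) (φ : Rep.res f M ⟶ N) (m : ℕ) (x : groupCohomology.cocycles M m) :
    (groupCohomology.iCocycles N m (groupCohomology.cocyclesMap f φ m x) :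
      (Fin m → G') → N.V) = fun g => φ.hom (groupCohomology.iCocycles M m x (f ∘ g)) := by
  have := ConcreteCategory.congr_hom
    (HomologicalComplex.cyclesMap_i (groupCohomology.cochainsMap f φ) m) x
  exact this

end Classes

/-! ### The representation `V^* ⊗ M` as `Hom(V, M)` -/

section DualTensor

variable {R G V : Type} [CommRing R] [Group G] [AddCommGroup V] [Module R V]

section Finite

variable [Module.Free R V] [Module.Finite R V] (ρ : Representation R G V) (M : Rep.{0} R G)

/-- The inverse of the isomorphism `V^* ⊗ M → Hom(V, M)`. -/
def toDualTensor (f : V →ₗ[R] M.V) : (dualTensor ρ M).V :=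
  show Module.Dual R V ⊗[R] M.V from (dualTensorHomEquiv R V M.V).symm f

theorem dualTensorEval_toDualTensor (f : V →ₗ[R] M.V) (v : V) :
    dualTensorEval (toDualTensor ρ M f) v = f v :=
  LinearMap.congr_fun ((dualTensorHomEquiv R V M.V).apply_symm_apply f) v

variable {ρ M}

theorem dualTensor_ext {s t : (dualTensor ρ M).V}
    (h : ∀ v, dualTensorEval s v = dualTensorEval t v) : s = t :=
  (dualTensorHomEquiv R V M.V).injective (LinearMap.ext h)

end Finite

variable {ρ : Representation R G V} {M : Rep.{0} R G}

theorem dualTensorEval_sub (s t : (dualTensor ρ M).V) (v : V) :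
    dualTensorEval (s - t) v = dualTensorEval s v - dualTensorEval t v :=
  LinearMap.congr_fun (map_sub (dualTensorHom R V M.V) s t) v

theorem dualTensorEval_add (s t : (dualTensor ρ M).V) (v : V) :
    dualTensorEval (s + t) v = dualTensorEval s v + dualTensorEval t v :=
  LinearMap.congr_fun (map_add (dualTensorHom R V M.V) s t) v

theorem dualTensorEval_zero (v : V) : dualTensorEval (0 : (dualTensor ρ M).V) v = 0 :=
  LinearMap.congr_fun (map_zero (dualTensorHom R V M.V)) v

/-- The map `V^* ⊗ M → M` evaluating at `v ∈ V`. -/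
def dualTensorEvalHom (ρ : Representation R G V) (M : Rep.{0} R G) (v : V) :
    (dualTensor ρ M).V →ₗ[R] M.V :=
  LinearMap.applyₗ v ∘ₗ (show Module.Dual R V ⊗[R] M.V →ₗ[R] V →ₗ[R] M.V from
    dualTensorHom R V M.V)

theorem dualTensorEval_cobd {m : ℕ} (w : (Fin m → G) → (dualTensor ρ M).V)
    (a : Fin (m + 1) → G) (v : V) :
    dualTensorEval (cobd (dualTensor ρ M).ρ w a) v =
      M.ρ (a 0) (dualTensorEval (w (Fin.tail a)) (ρ (a 0)⁻¹ v)) +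
        faceSum R (fun b => dualTensorEval (w b) v) a := by
  rw [cobd, dualTensorEval_add]
  refine congrArg₂ _ ?_ (faceSum_comp (dualTensorEvalHom ρ M v) w a).symm
  exact LinearMap.congr_fun (LinearMap.congr_fun
    (Representation.dualTensorHom_comm ρ M.ρ (a 0)) (w (Fin.tail a))) v

theorem cobd_toDualTensor [Module.Free R V] [Module.Finite R V] {m : ℕ}
    {c : (Fin m → G) → V →ₗ[R] M.V} (hc : cobd (ρ.linHom M.ρ) c = 0) :
    cobd (dualTensor ρ M).ρ (fun a => toDualTensor ρ M (c a)) = 0 := by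
  ext1 a
  refine dualTensor_ext fun v => ?_
  rw [dualTensorEval_cobd]
  simp only [dualTensorEval_toDualTensor]
  have h := faceSum_comp (R := R) (LinearMap.applyₗ (R := R) (M₂ := M.V) v) c a
  exact (congrArg₂ _ rfl h).trans
    ((LinearMap.congr_fun (congrFun hc a) v).trans (dualTensorEval_zero v).symm)

/-- The form of `exists_edge_primitive` for coefficients restricted from `A`. -/
theorem exists_edge_primitive_res {α A : Type} [Group A] {φ : A →* MulAut (FreeGroup α)}
    (M : Rep.{0} R A) {m : ℕ} (h : (Fin (m + 1) → FreeGroup α ⋊[φ] A) → M.V)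
    (f : (Fin (m + 1 + 1) → FreeGroup α ⋊[φ] A) → M.V)
    (hf : f = cobd (Rep.res (SemidirectProduct.rightHom (φ := φ)) M).ρ h)
    (hnorm : ∀ g, (∃ i, g i = 1) → f g = 0)
    (hfil : ∀ (x : FreeGroup α ⋊[φ] A) (a b : Fin (m + 1) → FreeGroup α ⋊[φ] A),
      (∀ i, (a i).right = (b i).right) → f (Fin.cons x a) = f (Fin.cons x b)) :
    ∃ E : (Fin m → A) → FreeGroup α → M.V, (∀ a γ δ, E a (γ * δ) = E a γ + E a δ) ∧
      ∀ (a : Fin (m + 1) → A) (γ : FreeGroup α),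
        f (Fin.cons (SemidirectProduct.inl γ) (SemidirectProduct.inr ∘ a)) =
          M.ρ (a 0) (E (Fin.tail a) (φ (a 0)⁻¹ γ)) + faceSum R (fun b => E b γ) a := by
  subst hf
  exact exists_edge_primitive (M.ρ.comp SemidirectProduct.rightHom) (fun v γ => by simp) h
    hnorm hfil

end DualTensor

/-! ### The Gysin map and a cocycle for `h_p` -/

section Gysin

variable {n : ℕ}

/-- The Gysin image of a class is unique. -/
theorem IsGysin.unique {p : ℕ} {M : Rep.{0} ℤ (A n)}
    {c : groupCohomology (Rep.res (proj n) M) (p + 1 + 1)}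
    {d d' : groupCohomology (dualTensorMod M) (p + 1)} (h : IsGysin (p + 1) M c d)
    (h' : IsGysin (p + 1) M c d') : d = d' := by
  obtain ⟨f₁, u₁, f, u, hf₁, rfl, hf, hu, hnorm, hfil, heval⟩ := h
  obtain ⟨f₂, u₂, f', u', hf₂, rfl, hf', hu', hnorm', hfil', heval'⟩ := h'
  obtain ⟨e, he⟩ := (π_eq_iff _ _ _ _).1 (hf₁.trans hf₂.symm)
  rw [hf, hf'] at he
  obtain ⟨E, hE, hEe⟩ := exists_edge_primitive_res M e (f - f') he
    (fun g hg => by rw [Pi.sub_apply, hnorm g hg, hnorm' g hg, sub_zero])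
    (fun x a b hab => by rw [Pi.sub_apply, Pi.sub_apply, hfil x a b hab, hfil' x a b hab])
  -- The `ℤ`-module structure of `M` has to be the one bundled in `M`, not the canonical one.
  refine (π_eq_iff _ _ _ _).2
    ⟨fun a => toDualTensor (hRep n) M (@hLift n M.V M.hV1 M.hV2 (E a) (hE a)), ?_⟩
  rw [hu, hu']
  ext1 a
  refine dualTensor_ext fun v => ?_
  obtain ⟨γ, rfl⟩ := cls_surjective v
  have h1 := hEe a γ
  have h2 : ∀ i, proj n ((SemidirectProduct.inr ∘ a : Fin (p + 1) → Abar n) i) = a i := fun i =>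
    SemidirectProduct.rightHom_inr _
  rw [Pi.sub_apply, heval, heval'] at h1
  simp only [h2] at h1
  rw [dualTensorEval_cobd, Pi.sub_apply, dualTensorEval_sub]
  simp only [dualTensorEval_toDualTensor]
  exact h1

/-- The explicit cochain representing `h_p`, with values in `H^* ⊗ H^{⊗ (p+1)}`. -/
def hTensorCochain (n p : ℕ) : (Fin p → A n) → (hCoeff n p).V :=
  fun a => toDualTensor (hRep n) (tensorMod n (p + 1)) (hCochain n p a)

theorem dualTensorEval_hTensorCochain {p : ℕ} (a : Fin p → A n) (v : H n) :
    dualTensorEval (hTensorCochain n p a) v = hCochain n p a v :=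
  dualTensorEval_toDualTensor (hRep n) (tensorMod n (p + 1)) (hCochain n p a) v

theorem cobd_hTensorCochain (n p : ℕ) : cobd (hCoeff n p).ρ (hTensorCochain n p) = 0 :=
  cobd_toDualTensor (ρ := hRep n) (M := tensorMod n (p + 1)) (c := hCochain n p)
    (cobd_iteratedCocycle (hRep n) johnson johnson_mul p)

theorem d_hTensorCochain (n p : ℕ) :
    inhomogeneousCochains.d (hCoeff n p) p (hTensorCochain n p) = 0 :=
  (d_eq_cobd (hCoeff n p) (hTensorCochain n p)).trans (cobd_hTensorCochain n p)

/-- The explicit cocycle on `Aut(F_n)` whose class is `h_p`. -/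
def hCocycle (n p : ℕ) : groupCohomology.cocycles (hCoeff n p) p :=
  @groupCohomology.cocyclesMk _ _ _ _ (hCoeff n p) p (hTensorCochain n p) (d_hTensorCochain n p)

theorem iCocycles_hCocycle (n p : ℕ) :
    groupCohomology.iCocycles (hCoeff n p) p (hCocycle n p) = hTensorCochain n p :=
  groupCohomology.iCocycles_mk (hTensorCochain n p) (d_hTensorCochain n p)

theorem isGysin_hCocycle (n p : ℕ) : IsGysin p (tensorMod n (p + 1)) (k0Pow n (p + 1))
    (groupCohomology.π (hCoeff n p) p (hCocycle n p)) := by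
  obtain ⟨e, he⟩ := exists_cupPow_k0_eq n p
  set f : (Fin (p + 1) → Abar n) → ⨂[ℤ]^(p + 1) (H n) := cup LinearMap.applyₗ
    (Representation.linHom ((hRep n).comp (proj n)) (tensorPowRep ((hRep n).comp (proj n)) (p + 1)))
    (k0 n) (fun g => hCochain n p (proj n ∘ g)) with hf
  have df : cobd (tensorPowRep ((hRep n).comp (proj n)) (p + 1)) f = 0 := by
    rw [eq_sub_of_add_eq he.symm, cobd_sub, cobd_cobd, sub_zero]
    exact (d_eq_cobd (Rep.of (tensorPowRep ((hRep n).comp (proj n)) (p + 1))) _).symm.trans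
      (d_cupPow ((hRep n).comp (proj n)) (k0 n) (k0_mul n) (p + 1))
  have df' : inhomogeneousCochains.d (Rep.res (proj n) (tensorMod n (p + 1))) (p + 1) f = 0 :=
    (d_eq_cobd (Rep.res (proj n) (tensorMod n (p + 1))) f).trans df
  have hfc : ∀ x a, f (Fin.cons x a) = Representation.linHom ((hRep n).comp (proj n))
      (tensorPowRep ((hRep n).comp (proj n)) (p + 1)) x (hCochain n p (proj n ∘ a)) (k0 n x) :=
    fun x a => by rw [hf, cup_cons]; rfl
  refine ⟨groupCohomology.cocyclesMk f df', hCocycle n p, f, hTensorCochain n p, ?_, rfl,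
    groupCohomology.iCocycles_mk _ _, iCocycles_hCocycle n p, ?_, ?_, ?_⟩
  · refine π_cocyclesMk_eq (Rep.res (proj n) (tensorMod n (p + 1))) df' _ (-e) ?_
    refine Eq.trans ?_ (cobd_neg (tensorPowRep ((hRep n).comp (proj n)) (p + 1)) e).symm
    rw [he]
    exact sub_add_cancel_left f _
  · rintro g ⟨i, hi⟩
    rw [← Fin.cons_self_tail g, hfc]
    induction i using Fin.cases with
    | zero =>
      rw [hi]
      exact map_zero _
    | succ i =>
      have h0 : hCochain n p (proj n ∘ Fin.tail g) = 0 :=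
        iteratedCocycle_eq_zero _ _ johnson_one _ ⟨i, by
          rw [Function.comp_apply, Fin.tail, hi, map_one]⟩
      rw [h0, map_zero]
      rfl
  · intro x a b hab
    rw [hfc, hfc, show proj n ∘ a = proj n ∘ b from funext hab]
  · intro γ a
    rw [dualTensorEval_hTensorCochain, hfc, Representation.linHom_apply]
    change tensorPowRep (hRep n) (p + 1) 1 (hCochain n p (proj n ∘ a) (hRep n 1 (cls γ))) = _
    rw [map_one, map_one]
    rfl

/-- The class `h_p` is represented by the explicit cocycle. -/
theorem hClass_eq (n : ℕ) {p : ℕ} (hp : 1 ≤ p) :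
    hClass n p = groupCohomology.π (hCoeff n p) p (hCocycle n p) := by
  obtain ⟨q, rfl⟩ := Nat.exists_eq_add_of_le' hp
  exact (Classical.epsilon_spec ⟨_, isGysin_hCocycle n (q + 1)⟩ :
    IsGysin (q + 1) _ _ (hClass n (q + 1))).unique (isGysin_hCocycle n (q + 1))

end Gysin

/-! ### Restriction to block automorphisms -/

section Block

variable {n₁ n₂ n : ℕ} (h : n₁ + n₂ ≤ n)

theorem ret₁_inc₁ (γ : F n₁) : ret₁ h (inc₁ h γ) = γ := DFunLike.congr_fun (ret₁_comp_inc₁ h) γ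

theorem ret₂_inc₂ (γ : F n₂) : ret₂ h (inc₂ h γ) = γ := DFunLike.congr_fun (ret₂_comp_inc₂ h) γ

theorem ret₁_inc₂ (γ : F n₂) : ret₁ h (inc₂ h γ) = 1 := DFunLike.congr_fun (ret₁_comp_inc₂ h) γ

theorem ret₂_inc₁ (γ : F n₁) : ret₂ h (inc₁ h γ) = 1 := DFunLike.congr_fun (ret₂_comp_inc₁ h) γ

theorem cls_one : cls (1 : F n) = 0 := rfl

theorem hCochain_inc₁ {p : ℕ} (a : Fin p → A n₁ × A n₂) (v : H n₁) :
    hCochain n p (iota h ∘ a) (hMap (inc₁ h) v) =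
      PiTensorProduct.map (fun _ => hMap (inc₁ h)) (hCochain n₁ p (Prod.fst ∘ a) v) :=
  iteratedCocycle_natural (hRep n₁) johnson (hRep n) johnson (hMap (inc₁ h)) _ _
    (fun i => LinearMap.congr_fun (hMap_inc₁_comm h (a i)))
    (fun i => johnson_natural _ (fun j => by rw [inc₁, FreeGroup.lift_apply_of, magnus_of]) _ _
      fun γ => (DFunLike.congr_fun (blockHom_comp_inc₁ h (a i)) γ).symm) v

theorem hCochain_inc₂ {p : ℕ} (a : Fin p → A n₁ × A n₂) (v : H n₂) :
    hCochain n p (iota h ∘ a) (hMap (inc₂ h) v) =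
      PiTensorProduct.map (fun _ => hMap (inc₂ h)) (hCochain n₂ p (Prod.snd ∘ a) v) :=
  iteratedCocycle_natural (hRep n₂) johnson (hRep n) johnson (hMap (inc₂ h)) _ _
    (fun i => LinearMap.congr_fun (hMap_inc₂_comm h (a i)))
    (fun i => johnson_natural _ (fun j => by rw [inc₂, FreeGroup.lift_apply_of, magnus_of]) _ _
      fun γ => (DFunLike.congr_fun (blockHom_comp_inc₂ h (a i)) γ).symm) v

/-- The explicit cocycle vanishes on the letters outside the two blocks. -/
theorem hCochain_of_fixed {p : ℕ} (hp : 1 ≤ p) (a : Fin p → A n₁ × A n₂) (i : Fin n)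
    (hi : n₁ + n₂ ≤ i) : hCochain n p (iota h ∘ a) (cls (FreeGroup.of i)) = 0 := by
  obtain ⟨q, rfl⟩ := Nat.exists_eq_add_of_le' hp
  have hfix : (iota h (a 0))⁻¹ (FreeGroup.of i) = FreeGroup.of i := by
    rw [← map_inv]
    change blockHom h (a 0)⁻¹ (FreeGroup.of i) = _
    rw [blockHom, FreeGroup.lift_apply_of, dif_neg (by omega), dif_neg (by omega)]
  have hj : johnson (iota h (a 0)) (cls (FreeGroup.of i)) = 0 := by
    rw [johnson_cls, hfix, magnus_of, map_zero, sub_zero]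
  rw [hCochain, iteratedCocycle_succ_apply, Function.comp_apply, hj, map_zero,
    LinearMap.zero_apply]

/-- On `Aut(F_{n₁}) × Aut(F_{n₂})` the explicit cocycle is block diagonal. -/
theorem hCochain_iota {p : ℕ} (hp : 1 ≤ p) (a : Fin p → A n₁ × A n₂) :
    hCochain n p (iota h ∘ a) =
      PiTensorProduct.map (fun _ => hMap (inc₁ h)) ∘ₗ hCochain n₁ p (Prod.fst ∘ a) ∘ₗ
          hMap (ret₁ h) +
        PiTensorProduct.map (fun _ => hMap (inc₂ h)) ∘ₗ hCochain n₂ p (Prod.snd ∘ a) ∘ₗ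
          hMap (ret₂ h) := by
  refine hom_H_ext fun i => ?_
  simp only [LinearMap.add_apply, LinearMap.comp_apply, hMap_cls]
  by_cases h₁ : (i : ℕ) < n₁
  · have e : FreeGroup.of i = inc₁ h (FreeGroup.of ⟨i, h₁⟩) := by simp [inc₁]
    rw [e, ← hMap_cls, hCochain_inc₁, ret₁_inc₁, ret₂_inc₁, cls_one]
    simp
  · by_cases h₂ : (i : ℕ) < n₁ + n₂
    · have e : FreeGroup.of i = inc₂ h (FreeGroup.of ⟨i - n₁, by omega⟩) := by
        rw [inc₂, FreeGroup.lift_apply_of]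
        congr 1
        ext
        simp only
        omega
      rw [e, ← hMap_cls, hCochain_inc₂, ret₂_inc₂, ret₁_inc₂, cls_one]
      simp
    · rw [hCochain_of_fixed h hp a i (by omega)]
      have e₁ : ret₁ h (FreeGroup.of i) = 1 := by simp [ret₁, h₁]
      have e₂ : ret₂ h (FreeGroup.of i) = 1 := by simp [ret₂, h₂]
      rw [e₁, e₂, cls_one, cls_one]
      simp

theorem dualTensorHom_mixedMap {R V W : Type} [CommRing R] [AddCommGroup V] [Module R V]
    [AddCommGroup W] [Module R W] (j : V →ₗ[R] W) (q : W →ₗ[R] V) (m : ℕ)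
    (t : Module.Dual R V ⊗[R] (⨂[R]^m V)) :
    dualTensorHom R W (⨂[R]^m W) (mixedMap j q m t) =
      PiTensorProduct.map (fun _ => j) ∘ₗ dualTensorHom R V (⨂[R]^m V) t ∘ₗ q := by
  induction t with
  | zero => simp
  | add s t hs ht => rw [map_add, map_add, hs, ht, map_add, LinearMap.add_comp, LinearMap.comp_add]
  | tmul f t =>
    ext v
    simp [mixedMap, Module.Dual.transpose_apply]

theorem iotaPullback_hClass {p : ℕ} (hp : 1 ≤ p) :
    iotaPullback h (hCoeff n p) p (hClass n p) =
      varpi₁Pullback h p (hClass n₁ p) + varpi₂Pullback h p (hClass n₂ p) := by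
  rw [hClass_eq n hp, hClass_eq n₁ hp, hClass_eq n₂ hp, iotaPullback, varpi₁Pullback,
    varpi₂Pullback, groupCohomology.π_map_apply, groupCohomology.π_map_apply,
    groupCohomology.π_map_apply, ← map_add]
  congr 1
  apply iCocycles_injective
  rw [map_add, iCocycles_cocyclesMap, iCocycles_cocyclesMap, iCocycles_cocyclesMap,
    iCocycles_hCocycle, iCocycles_hCocycle, iCocycles_hCocycle]
  ext1 a
  refine dualTensor_ext (ρ := hRep n) (M := tensorMod n (p + 1)) fun v => ?_
  have h1 := dualTensorHom_mixedMap (hMap (inc₁ h)) (hMap (ret₁ h)) (p + 1)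
    (hTensorCochain n₁ p (Prod.fst ∘ a))
  have h2 := dualTensorHom_mixedMap (hMap (inc₂ h)) (hMap (ret₂ h)) (p + 1)
    (hTensorCochain n₂ p (Prod.snd ∘ a))
  refine (dualTensorEval_hTensorCochain (iota h ∘ a) v).trans ?_
  rw [hCochain_iota h hp]
  refine Eq.trans ?_ (dualTensorEval_add (ρ := hRep n) (M := tensorMod n (p + 1)) _ _ v).symm
  refine congrArg₂ (fun x y : ⨂[ℤ]^(p + 1) (H n) => x + y) ?_ ?_
  · refine Eq.trans ?_ (LinearMap.congr_fun h1 v).symm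
    exact congrArg _ (dualTensorEval_hTensorCochain (Prod.fst ∘ a) (hMap (ret₁ h) v)).symm
  · refine Eq.trans ?_ (LinearMap.congr_fun h2 v).symm
    exact congrArg _ (dualTensorEval_hTensorCochain (Prod.snd ∘ a) (hMap (ret₂ h) v)).symm

theorem contraction_mixedMap {R V W : Type} [CommRing R] [AddCommGroup V] [Module R V]
    [AddCommGroup W] [Module R W] (j : V →ₗ[R] W) (q : W →ₗ[R] V) (hqj : q ∘ₗ j = LinearMap.id)
    (p : ℕ) : contraction R W p ∘ₗ mixedMap j q (p + 1) =
      (PiTensorProduct.map fun _ => j) ∘ₗ contraction R V p := by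
  ext f v
  have h : q (j (v 0)) = v 0 := LinearMap.congr_fun hqj (v 0)
  simp only [TensorProduct.AlgebraTensorModule.curry_apply, LinearMap.compMultilinearMap_apply,
    TensorProduct.curry_apply, LinearMap.coe_restrictScalars, LinearMap.comp_apply, mixedMap,
    TensorProduct.map_tmul, PiTensorProduct.map_tprod, contraction_tmul_tprod,
    Module.Dual.transpose_apply, h, map_smul]
  rfl

/-- Functoriality of group cohomology for a square of coefficient maps. -/
theorem map_map_eq_map_map {R G G' : Type} [CommRing R] [Group G] [Group G'] {M N : Rep.{0} R G}
    {M' N' : Rep.{0} R G'} (f : G' →* G) (r : M ⟶ N) (r' : M' ⟶ N') (s : Rep.res f M ⟶ M')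
    (t : Rep.res f N ⟶ N')
    (hsq : t.hom.toLinearMap ∘ₗ r.hom.toLinearMap = r'.hom.toLinearMap ∘ₗ s.hom.toLinearMap)
    (m : ℕ) (x : groupCohomology M m) :
    groupCohomology.map f t m (groupCohomology.map (MonoidHom.id G) r m x) =
      groupCohomology.map (MonoidHom.id G') r' m (groupCohomology.map f s m x) := by
  have h : groupCohomology.map (MonoidHom.id G) r m ≫ groupCohomology.map f t m =
      groupCohomology.map f s m ≫ groupCohomology.map (MonoidHom.id G') r' m := by
    rw [← groupCohomology.map_comp, ← groupCohomology.map_comp]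
    exact groupCohomology.map_congr rfl hsq m
  exact ConcreteCategory.congr_hom h x

theorem iotaPullback_hBarClass {p : ℕ} (hp : 1 ≤ p) :
    iotaPullback h (tensorMod n p) p (hBarClass n p) =
      varpi₁PullbackBar h p (hBarClass n₁ p) + varpi₂PullbackBar h p (hBarClass n₂ p) := by
  have e₁ : hMap (ret₁ h) ∘ₗ hMap (inc₁ h) = LinearMap.id := by
    rw [hMap_comp, ret₁_comp_inc₁]
    exact LinearMap.ext fun v => by obtain ⟨γ, rfl⟩ := cls_surjective v; rfl
  have e₂ : hMap (ret₂ h) ∘ₗ hMap (inc₂ h) = LinearMap.id := by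
    rw [hMap_comp, ret₂_comp_inc₂]
    exact LinearMap.ext fun v => by obtain ⟨γ, rfl⟩ := cls_surjective v; rfl
  let r := (Rep.resFunctor (iota h)).map (rMap n p)
  have h0 := map_map_eq_map_map (iota h) (rMap n p) r (𝟙 _) (𝟙 _) rfl p (hClass n p)
  have h1 := map_map_eq_map_map (MonoidHom.fst (A n₁) (A n₂)) (rMap n₁ p) r (coeffMap₁ h p)
    (tensorMap₁ h p) (contraction_mixedMap _ _ e₁ p).symm p (hClass n₁ p)
  have h2 := map_map_eq_map_map (MonoidHom.snd (A n₁) (A n₂)) (rMap n₂ p) r (coeffMap₂ h p)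
    (tensorMap₂ h p) (contraction_mixedMap _ _ e₂ p).symm p (hClass n₂ p)
  refine h0.trans (Eq.trans ?_ (congrArg₂ _ h1 h2).symm)
  rw [← map_add]
  exact congrArg _ (iotaPullback_hClass h hp)

end Block

end TwistedMM

end

theorem proposition1p2 (n₁ n₂ n p : ℕ) (hn : n₁ + n₂ ≤ n) (hp : 1 ≤ p) :
    TwistedMM.iotaPullback hn (TwistedMM.hCoeff n p) p (TwistedMM.hClass n p) =
        TwistedMM.varpi₁Pullback hn p (TwistedMM.hClass n₁ p) +
          TwistedMM.varpi₂Pullback hn p (TwistedMM.hClass n₂ p) ∧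
      TwistedMM.iotaPullback hn (TwistedMM.tensorMod n p) p (TwistedMM.hBarClass n p) =
        TwistedMM.varpi₁PullbackBar hn p (TwistedMM.hBarClass n₁ p) +
          TwistedMM.varpi₂PullbackBar hn p (TwistedMM.hBarClass n₂ p) :=
  ⟨TwistedMM.iotaPullback_hClass hn hp, TwistedMM.iotaPullback_hBarClass hn hp⟩
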